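/- **Setting.** Let $\mathrm{sign}(r)=+1$ for $r\ge 0$ and $-1$ for $r<0$, and let $\mathcal C=\{x\mapsto \mathrm{sign}(w^\top x+b): w\in\mathbb R^2,\ b\in\mathbb R\}$ be the class of halfspaces in $\mathcal X=\mathbb R^2$. *Adversarial injection model.* Given the horizon $T$, the learner is fixed first. An adversary then fixes a probability distribution $\mathcal D$ on $\mathbb R^2$ and a target $c^\star\in\mathcal C$, both hidden from the learner. In each round $t=1,\dots,T$ the adversary chooses a hidden bit $q_t\in\{0,1\}$; if $q_t=0$, the instance $x_t$ is a fresh draw from $\mathcal D$, independent of the past, and if $q_t=1$ the adversary chooses $x_t\in\mathbb R^2$. The adversary's choices in round $t$ may depend on everything that happened in the earlier rounds and on private randomness. The learner sees $x_t$ and the earlier labeled examples $(x_s,c^\star(x_s))$, $s<t$ (never the bits $q_s$), outputs $\hat y_t\in\{+1,-1,\perp\}$, and then sees $y_t=c^\star(x_t)$. All strategies are measurable. Put $$err_{\mathrm{mis}}=\sum_{t=1}^T\mathbf 1[\hat y_t\ne y_t\wedge \hat y_t\ne\perp],\qquad err_{\mathrm{abs}}=\sum_{t=1}^T\mathbf 1[\hat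 y_t=\perp\wedge\, q_t=0].$$ *Certificate dimension.* Let $\mathcal L=\mathcal X\times\{\pm1\}$. A class $\mathcal H$ of functions $\mathcal X\to\{\pm1\}$ has certificate dimension $k$ with parameters $(m,n)$, where $m,n\ge1$, if there is a function $\sigma$ from pairs (concept in $\mathcal H$, $(k-1)$-element subset of $\mathcal L$) to $\{0,\dots,n-1\}$ such that for every $h\in\mathcal H$ and every $S\subseteq\mathcal L$ with $|S|=m$ labeled by $h$ there are $U\subseteq S$ with $|U|=k$ and $(x,y)\in U$ such that every $h'\in\mathcal H$ that agrees with all labels in $S\setminus\{(x,y)\}$ and satisfies $\sigma(h',U\setminus\{(x,y)\})=\sigma(h,U\setminus\{(x,y)\})$ has $h'(x)=h(x)=y$. **Theorem.** 1. For all distinct $s_+,s_-\in\mathbb R^2$, the class $\{x\mapsto\mathrm{sign}(w^\top x-b): w\in\mathbb R^2,\ b\in\mathbb R,\ w^\top s_+\ge b>w^\top s_-\}$ of halfspaces that label $s_+$ positive and $s_-$ negative has certificate dimension $3$ with parameters $m=7$, $n=3$. 2. Halfspaces in $\mathbb R^2$ can be learned in the adversarial injection model with expected combined error $\tilde{\mathcal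 O}(T^{2/3})$: there are absolute constants $K$ and $r$ such that for every $T\ge1$ there is a (deterministic) learner for which, for every distribution $\mathcal D$ on $\mathbb R^2$, every target $c^\star\in\mathcal C$ and every adaptive, possibly randomized adversary, $$\mathbb E[err_{\mathrm{mis}}+err_{\mathrm{abs}}]\le K\,T^{2/3}\,(1+\log T)^{r}.$$ -/

import Mathlib

open MeasureTheory

namespace AdversarialInjection

/-! ### Labels, concepts, version spaces, certificate dimension -/

/-- Labels `±1`: `true` stands for `+1` and `false` for `-1`. -/
abbrev Label := Bool

/-- The sign function with `sign 0 = +1`. -/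
noncomputable def sign (r : ℝ) : Label := decide (0 ≤ r)

/-- Concepts `𝒳 → {±1}`. -/
abbrev Concept (X : Type*) := X → Label

/-- The version space `𝒱(S)`: the concepts of the class `C` that agree with every labeled example
in the finite set `S`. -/
def versionSpace {X : Type*} (C : Set (Concept X)) (S : Finset (X × Label)) : Set (Concept X) :=
  {h | h ∈ C ∧ ∀ p ∈ S, h p.1 = p.2}

open Classical in
/-- The class `C` has certificate dimension `k` with parameters `(m, n)`: there is a certificate
function `σ` from concepts and `(k - 1)`-element sets of labeled examples to `{0, …, n - 1}` such
that any `m`-element set `S` labeled by any `h ∈ C` contains a `k`-element set `U` and an example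
`p = (x, y) ∈ U` for which every `h'` in the version space of `S \ {p}` having the same certificate
as `h` on `U \ {p}` also has `h' x = h x = y`.  (Only the values of `σ` on concepts of `C` and on
`(k - 1)`-element sets matter, so `σ` is taken to be total.) -/
def HasCertificateDimension {X : Type*} (C : Set (Concept X)) (k m n : ℕ) : Prop :=
  1 ≤ m ∧ 1 ≤ n ∧
    ∃ σ : Concept X → Finset (X × Label) → Fin n,
      ∀ h ∈ C, ∀ S : Finset (X × Label), S.card = m → (∀ p ∈ S, h p.1 = p.2) →
        ∃ U : Finset (X × Label), U ⊆ S ∧ U.card = k ∧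
          ∃ p ∈ U, ∀ h' ∈ versionSpace C (S.erase p),
            σ h' (U.erase p) = σ h (U.erase p) → h' p.1 = h p.1 ∧ h p.1 = p.2

/-! ### Halfspaces in the plane -/

/-- The Euclidean plane. -/
abbrev Plane := EuclideanSpace ℝ (Fin 2)

/-- The class of halfspaces `x ↦ sign (⟨w, x⟩ + b)` of the plane, `w ∈ ℝ²`, `b ∈ ℝ`. -/
def halfspaces : Set (Concept Plane) :=
  {h | ∃ (w : Plane) (b : ℝ), h = fun x => sign (inner ℝ w x + b)}

/-- The halfspaces `x ↦ sign (⟨w, x⟩ - b)` with `⟨w, s₊⟩ ≥ b > ⟨w, s₋⟩`, i.e. those for which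
`sPos` is a positive point and `sNeg` a negative one. -/
def anchoredHalfspaces (sPos sNeg : Plane) : Set (Concept Plane) :=
  {h | ∃ (w : Plane) (b : ℝ), inner ℝ w sPos ≥ b ∧ b > inner ℝ w sNeg ∧
    h = fun x => sign (inner ℝ w x - b)}

/-! ### The adversarial injection model -/

/-- What a learner may output: a label, or abstention `⊥`. -/
inductive Prediction where
  | label (y : Label)
  | abstain

instance : MeasurableSpace Prediction := ⊤

/-- The record of one round: the instance `x`, the hidden bit `q` (`false` for an i.i.d. round,
`true` for an injected one), the learner's output `ŷ` and the true label `y`, in this order. -/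
abbrev Round (X : Type*) := X × Bool × Prediction × Label

/-- A (deterministic) learner: its output in a round is a measurable function of the labeled
examples of the preceding rounds and of the present instance. It never sees the hidden bits. -/
structure Learner (X : Type*) [MeasurableSpace X] where
  predict : (t : ℕ) → (Fin t → X × Label) → X → Prediction
  measurable_predict : ∀ t, Measurable fun p : (Fin t → X × Label) × X => predict t p.1 p.2

/-- An adaptive, possibly randomized adversary: before a round it chooses, as measurable functions
of its private random seed in `Ω` and of the complete record of the preceding rounds, the hidden
bit and the instance that is injected in case the bit is `true`. -/
structure Adversary (Ω X : Type*) [MeasurableSpace Ω] [MeasurableSpace X] where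
  bit : (t : ℕ) → Ω → (Fin t → Round X) → Bool
  inject : (t : ℕ) → Ω → (Fin t → Round X) → X
  measurable_bit : ∀ t, Measurable fun p : Ω × (Fin t → Round X) => bit t p.1 p.2
  measurable_inject : ∀ t, Measurable fun p : Ω × (Fin t → Round X) => inject t p.1 p.2

section Protocol

variable {Ω X : Type*} [MeasurableSpace Ω] [MeasurableSpace X]

/-- Play one round after the record `H` of `t` rounds: the learner `L` against the adversary `A`
with seed `ω` and target concept `c`, where `z` is nature's draw for this round (it is the instance
of the round if the hidden bit is `false`). -/
def playRound (L : Learner X) (c : Concept X) (A : Adversary Ω X) (ω : Ω) (z : X)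
    (t : ℕ) (H : Fin t → Round X) : Round X :=
  let q : Bool := A.bit t ω H
  let x : X := if q = true then A.inject t ω H else z
  (x, q, L.predict t (fun s => ((H s).1, (H s).2.2.2)) x, c x)

/-- The record of the first `t` rounds, where `z s` is nature's draw for the round number `s`;
rounds are numbered from `0`. -/
def record (L : Learner X) (c : Concept X) (A : Adversary Ω X) (ω : Ω) (z : ℕ → X) :
    (t : ℕ) → Fin t → Round X
  | 0 => Fin.elim0
  | t + 1 => Fin.snoc (α := fun _ => Round X) (record L c A ω z t)
      (playRound L c A ω (z t) t (record L c A ω z t))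

open Classical in
/-- The number of misclassifications in a record: rounds with `ŷ ≠ y` and `ŷ ≠ ⊥`. -/
noncomputable def errMis {T : ℕ} (H : Fin T → Round X) : ℝ :=
  ∑ t, if (H t).2.2.1 ≠ Prediction.label (H t).2.2.2 ∧ (H t).2.2.1 ≠ Prediction.abstain
    then 1 else 0

open Classical in
/-- The number of incorrect abstentions in a record: i.i.d. rounds with `ŷ = ⊥`. -/
noncomputable def errAbs {T : ℕ} (H : Fin T → Round X) : ℝ :=
  ∑ t, if (H t).2.2.1 = Prediction.abstain ∧ (H t).2.1 = false then 1 else 0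

/-- The combined error over `T` rounds, as a function of the adversary's seed and of nature's
draws. -/
noncomputable def combinedError (L : Learner X) (c : Concept X) (A : Adversary Ω X) (T : ℕ)
    (p : Ω × (ℕ → X)) : ℝ :=
  errMis (record L c A p.1 p.2 T) + errAbs (record L c A p.1 p.2 T)

/-- The joint law of the adversary's seed (law `μ`) and of nature's draws, which are i.i.d. with
law `D` and independent of the seed. -/
noncomputable def protocolLaw (μ : Measure Ω) (D : Measure X) [IsProbabilityMeasure D] :
    Measure (Ω × (ℕ → X)) :=
  μ.prod (Measure.infinitePi fun _ : ℕ => D)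

end Protocol

end AdversarialInjection

namespace AdversarialInjection

/-! ### Certification by margins -/

/-! A halfspace is the sign of an affine function `g`; its margin is `|g|`. Let `a` and `b` have the
label opposite to that of `s`, with `|g a| ≤ |g b|`. If `x - s = α (a - s) + β (b - s)` with `β ≥ 0`
and `α + β ≥ 1`, then `g x - g s = (α + β)(g a - g s) + β (g b - g a)`, so `x` lies on the side of
`a`, at least as deep. Conversely, among any four points opposite to `s` some point is certified in
this way by two others (`exists_certified_of_four`, by sorting directions seen from `s`). So one
margin comparison is all that has to be known about the halfspace. `MarginCertified` isolates these
two facts, and the rest uses little else.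

Certificate dimension: seven examples contain four with one label, the anchor of the other label
plays `s`, and the certificate of a pair is the outcome of its margin comparison, one of three.

Learning: margins are hidden, so the learner lets every pair of past examples vote that has never
certified a wrong label, and predicts a label with `α` votes. A mistake discredits at least `α` of
at most `T ^ 2` pairs, apart from two mistakes made while one label is unseen; hence at most `2 + T
^ 2 / α` mistakes (`card_mistakes_le`). Pairs in the true margin order are never discredited, so an
abstention means that fewer than `α` of them certify the instance. If each of `n` points with one
label is certified by fewer than `α` pairs of the others, counting four-element subsets gives `n =
O(√α)` (`card_le_of_forall_card_certifying_lt`). By exchangeability a fresh draw after `N` draws is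
thus uncertified with probability `O(√α / (N + 1))`, and the sum over `N` is `O(√α log T)`.

The adversary decides adaptively which rounds are fresh draws. Therefore the expected number of
uncertified points among the remaining draws serves as a potential that does not grow in expectation
along the play (`lintegral_sum_abstention_le`). Draws are counted only once both labels have been
seen: the anchors are then frozen, and later draws are independent of them. The choice `α ≈ T ^
(4/3)` balances both errors. -/

/-- The relation `cert s a b x` certifies, in the presence of a margin function `d`, that `x` has
the label of `a` and `b`, opposite to the label of the anchor `s`, as soon as `d a ≤ d b`; and every
four points with a label opposite to the one of `s` contain a certified one. -/
structure MarginCertified {X : Type*} (cert : X → X → X → X → Prop) (d : X → ℝ) (c : Concept X) :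
    Prop where
  sound : ∀ s a b x, c a = c b → c s ≠ c a → d a ≤ d b → cert s a b x → c x = c a
  rich : ∀ (s : X) (v : Fin 4 → X), (∀ i, c (v i) ≠ c s) →
    ∃ p q r : Fin 4, p ≠ q ∧ p ≠ r ∧ q ≠ r ∧ d (v q) ≤ d (v r) ∧ cert s (v q) (v r) (v p)

/-- `x` lies in the part of the plane that any line separating `s` from `a` and `b` and at least as
close to `a` as to `b` must leave on the side of `a` and `b`. -/
def Extends (s a b x : Plane) : Prop :=
  ∃ α β : ℝ, x - s = α • (a - s) + β • (b - s) ∧ 0 ≤ β ∧ 1 ≤ α + β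

/-- Among three points of the right half-plane sorted by slope, one is certified by the two others,
or the middle one is the leftmost. -/
lemma certified_or_lt_of_sorted {a b c s t u : ℝ} (ha : 0 < a) (hb : 0 < b) (hc : 0 < c)
    (hst : s ≤ t) (htu : t ≤ u) :
    (∃ α β : ℝ, b = α * a + β * c ∧ t * b = α * (s * a) + β * (u * c) ∧ 0 ≤ α ∧ 0 ≤ β ∧
      1 ≤ α + β) ∨
    (a ≤ b ∧ ∃ α β : ℝ, c = α * a + β * b ∧ u * c = α * (s * a) + β * (t * b) ∧ 0 ≤ β ∧
      1 ≤ α + β) ∨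
    (c ≤ b ∧ ∃ α β : ℝ, a = α * c + β * b ∧ s * a = α * (u * c) + β * (t * b) ∧ 0 ≤ β ∧
      1 ≤ α + β) ∨
    (b < a ∧ b < c) := by
  -- The middle point lies in the cone spanned by the outer two, since its slope is between theirs.
  -- If all slopes coincide, a multiple of the first point suffices; otherwise Cramer's rule gives
  -- the weights.
  obtain ⟨l, m, hl, hm, h1, h2⟩ : ∃ l m : ℝ, 0 ≤ l ∧ 0 ≤ m ∧ b = l * a + m * c ∧
      t * b = l * (s * a) + m * (u * c) := by
    rcases (hst.trans htu).eq_or_lt with h | h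
    · obtain rfl : s = t := le_antisymm hst (h ▸ htu)
      exact ⟨b / a, 0, by positivity, le_rfl, by field_simp; simp, by field_simp; simp⟩
    · have h' : 0 < u - s := sub_pos.2 h
      have h1 : 0 ≤ u - t := sub_nonneg.2 htu
      have h2 : 0 ≤ t - s := sub_nonneg.2 hst
      exact ⟨b * (u - t) / ((u - s) * a), b * (t - s) / ((u - s) * c), by positivity,
        by positivity, by field_simp; ring, by field_simp; ring⟩
  by_cases hlm : 1 ≤ l + m
  · exact .inl ⟨l, m, h1, h2, hl, hm, hlm⟩
  -- Now `l + m < 1`: the middle point is inside the triangle of the origin and the outer two, and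
  -- an outer point can be expressed through the other two with coefficients of sum at least `1`.
  -- The required order of first coordinates selects which outer point to take.
  push Not at hlm
  rcases lt_or_ge b a with hba | hba
  · rcases lt_or_ge b c with hbc | hbc
    · exact .inr (.inr (.inr ⟨hba, hbc⟩))
    · have hl0 : 0 < l := by
        rcases hl.eq_or_lt with h | h
        · subst h; nlinarith
        · exact h
      refine .inr (.inr (.inl ⟨hbc, -m / l, 1 / l, ?_, ?_, by positivity, ?_⟩))
      · field_simp; linarith
      · field_simp; linarith
      · rw [← add_div, le_div_iff₀ hl0]; linarith
  · have hm0 : 0 < m := by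
      rcases hm.eq_or_lt with h | h
      · subst h; nlinarith
      · exact h
    refine .inr (.inl ⟨hba, -l / m, 1 / m, ?_, ?_, by positivity, ?_⟩)
    · field_simp; linarith
    · field_simp; linarith
    · rw [← add_div, le_div_iff₀ hm0]; linarith

/-- Among four points of the right half-plane, one is certified by two others. -/
lemma exists_certified_of_four {A B : Fin 4 → ℝ} (hA : ∀ i, 0 < A i) :
    ∃ p q r : Fin 4, p ≠ q ∧ p ≠ r ∧ q ≠ r ∧ A q ≤ A r ∧ ∃ α β : ℝ,
      A p = α * A q + β * A r ∧ B p = α * B q + β * B r ∧ 0 ≤ β ∧ 1 ≤ α + β := by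
  set t : Fin 4 → ℝ := fun i => B i / A i with ht
  have hB : ∀ i, B i = t i * A i := fun i => by rw [ht]; field_simp [(hA i).ne']
  set e := Tuple.sort t
  have hmono : Monotone (t ∘ e) := Tuple.monotone_sort t
  have key : ∀ i j k : Fin 4, i < j → j < k →
      (∃ p q r : Fin 4, p ≠ q ∧ p ≠ r ∧ q ≠ r ∧ A q ≤ A r ∧ ∃ α β : ℝ,
        A p = α * A q + β * A r ∧ B p = α * B q + β * B r ∧ 0 ≤ β ∧ 1 ≤ α + β) ∨
      (A (e j) < A (e i) ∧ A (e j) < A (e k)) := by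
    intro i j k hij hjk
    have nij : e i ≠ e j := e.injective.ne hij.ne
    have njk : e j ≠ e k := e.injective.ne hjk.ne
    have nik : e i ≠ e k := e.injective.ne (hij.trans hjk).ne
    simp only [hB]
    rcases certified_or_lt_of_sorted (hA (e i)) (hA (e j)) (hA (e k)) (hmono hij.le)
      (hmono hjk.le) with ⟨α, β, h1, h2, h3, h4, h5⟩ | ⟨h0, α, β, h1, h2, h3, h4⟩ |
        ⟨h0, α, β, h1, h2, h3, h4⟩ | h
    · rcases le_total (A (e i)) (A (e k)) with h | h
      · exact .inl ⟨e j, e i, e k, nij.symm, njk, nik, h, α, β, h1, h2, h4, h5⟩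
      · exact .inl ⟨e j, e k, e i, njk, nij.symm, nik.symm, h, β, α, by linarith, by
          simp only [Function.comp] at h2; linarith, h3, by linarith⟩
    · exact .inl ⟨e k, e i, e j, nik.symm, njk.symm, nij, h0, α, β, h1, h2, h3, h4⟩
    · exact .inl ⟨e i, e k, e j, nik, nij, njk.symm, h0, α, β, h1, h2, h3, h4⟩
    · exact .inr h
  -- If both overlapping triples fail, the second point would be strictly left of the third and the
  -- third strictly left of the second.
  rcases key 0 1 2 (by decide) (by decide) with h | h
  · exact h
  rcases key 1 2 3 (by decide) (by decide) with h' | h'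
  · exact h'
  exact absurd h.2 h'.1.not_gt

lemma sign_eq_true {r : ℝ} : sign r = true ↔ 0 ≤ r := by simp [sign]

lemma sign_eq_false {r : ℝ} : sign r = false ↔ r < 0 := by simp [sign]

lemma abs_add_abs_of_sign_ne {x y : ℝ} (h : sign x ≠ sign y) :
    0 < |x| + |y| ∧ ((|x| + |y| = x - y ∧ sign y = false) ∨ (|x| + |y| = -(x - y) ∧ sign y = true)) := by
  rcases lt_or_ge y 0 with hy | hy <;> rcases lt_or_ge x 0 with hx | hx
  · simp [sign_eq_false.2 hx, sign_eq_false.2 hy] at h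
  · rw [abs_of_nonneg hx, abs_of_neg hy]
    exact ⟨by linarith, .inl ⟨by ring, sign_eq_false.2 hy⟩⟩
  · rw [abs_of_neg hx, abs_of_nonneg hy]
    exact ⟨by linarith, .inr ⟨by ring, sign_eq_true.2 hy⟩⟩
  · simp [sign_eq_true.2 hx, sign_eq_true.2 hy] at h

/-- Two linear forms with orthogonal nonzero directions separate the points of the plane. -/
lemma eq_of_inner_eq {w u v : Plane} (hw : w ≠ 0) (h : inner ℝ w u = (inner ℝ w v : ℝ))
    (h' : w 0 * u 1 - w 1 * u 0 = w 0 * v 1 - w 1 * v 0) : u = v := by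
  simp only [PiLp.inner_apply, Fin.sum_univ_two, RCLike.inner_apply, conj_trivial] at h
  have hpos : 0 < w 0 ^ 2 + w 1 ^ 2 := by
    by_contra hc
    have h0 : w 0 = 0 := by nlinarith [sq_nonneg (w 0), sq_nonneg (w 1)]
    have h1 : w 1 = 0 := by nlinarith [sq_nonneg (w 0), sq_nonneg (w 1)]
    exact hw (by ext i; fin_cases i <;> simp [h0, h1])
  ext i
  fin_cases i
  · exact mul_left_cancel₀ hpos.ne' (by simp only [Fin.zero_eta]; linear_combination w 0 * h - w 1 * h')
  · exact mul_left_cancel₀ hpos.ne' (by simp only [Fin.mk_one]; linear_combination w 1 * h + w 0 * h')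

/-- Certification is a linear statement about `g x - g s`, which is why the absolute values are
removed by sign cases. For richness, the plane is described from `s` by the coordinate across the
boundary line and the one along it. -/
theorem marginCertified_halfspace (w : Plane) (b : ℝ) :
    MarginCertified Extends (fun x => |inner ℝ w x + b|) (fun x => sign (inner ℝ w x + b)) := by
  constructor
  · rintro s a e x hab hs hd ⟨α, β, hx, hβ, hαβ⟩
    have hx' := congrArg (fun u => (inner ℝ w u : ℝ)) hx
    simp only [inner_add_right, inner_sub_right, inner_smul_right] at hx'
    set g := fun u => (inner ℝ w u : ℝ) + b with hg
    have hx'' : g x - g s = α * (g a - g s) + β * (g e - g s) := by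
      simp only [hg]; linear_combination hx'
    change sign (g a) = sign (g e) at hab
    change sign (g s) ≠ sign (g a) at hs
    change |g a| ≤ |g e| at hd
    change sign (g x) = sign (g a)
    obtain ⟨hp, h⟩ := abs_add_abs_of_sign_ne hs.symm
    obtain ⟨hp', h'⟩ := abs_add_abs_of_sign_ne (hab ▸ hs.symm)
    -- These two nonnegative terms add up, up to the common sign, to `g x - g a`.
    have hpos : 0 ≤ (α + β - 1) * (|g a| + |g s|) := mul_nonneg (by linarith) hp.le
    have hpos' : 0 ≤ β * (|g e| - |g a|) := mul_nonneg hβ (by linarith)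
    rcases h with ⟨h, hs'⟩ | ⟨h, hs'⟩ <;> rcases h' with ⟨h', hs''⟩ | ⟨h', hs''⟩
    · have ha : sign (g a) = true := by rw [hs'] at hs; simpa using hs.symm
      rw [ha]; rw [sign_eq_true] at ha ⊢
      rw [h] at hpos
      rw [show |g e| - |g a| = g e - g a by linarith] at hpos'
      linarith
    · simp [hs'] at hs''
    · simp [hs'] at hs''
    · have ha : sign (g a) = false := by rw [hs'] at hs; simpa using hs.symm
      rw [ha]; rw [sign_eq_false] at ha ⊢
      rw [h] at hpos
      rw [show |g e| - |g a| = -(g e - g a) by linarith] at hpos'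
      linarith
  · intro s v hv
    set g := fun u => (inner ℝ w u : ℝ) + b with hg
    change ∀ i, sign (g (v i)) ≠ sign (g s) at hv
    have hw : w ≠ 0 := by
      rintro rfl
      exact hv 0 (by simp [hg])
    -- As the labels differ, `|g (v i)| + |g s|` equals `|g (v i) - g s|` and is positive; the
    -- common summand `|g s|` does not affect the order of the margins.
    obtain ⟨p, q, r, hpq, hpr, hqr, hle, α, β, h1, h2, h3, h4⟩ := exists_certified_of_four
      (A := fun i => |g (v i)| + |g s|)
      (B := fun i => w 0 * (v i - s) 1 - w 1 * (v i - s) 0)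
      (fun i => (abs_add_abs_of_sign_ne (hv i)).1)
    refine ⟨p, q, r, hpq, hpr, hqr, by simpa using hle, α, β, ?_, h3, h4⟩
    refine eq_of_inner_eq hw ?_ ?_
    · simp only [inner_add_right, inner_sub_right, inner_smul_right]
      rcases (abs_add_abs_of_sign_ne (hv p)).2 with ⟨e1, f1⟩ | ⟨e1, f1⟩ <;>
      rcases (abs_add_abs_of_sign_ne (hv q)).2 with ⟨e2, f2⟩ | ⟨e2, f2⟩ <;>
      rcases (abs_add_abs_of_sign_ne (hv r)).2 with ⟨e3, f3⟩ | ⟨e3, f3⟩ <;>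
      first
      | (exfalso; simp_all; done)
      | (simp only [e1, e2, e3] at h1
         simp only [hg] at h1
         linarith)
    · simp only [PiLp.add_apply, PiLp.smul_apply, smul_eq_mul, PiLp.sub_apply] at h2 ⊢
      linear_combination h2

/-! ### The certificate dimension of anchored halfspaces -/

open Classical in
/-- Comparison of the values of `d` at the two points of a two-element set. -/
noncomputable def comparison {X : Type*} (d : X → ℝ) (V : Finset (X × Label)) : Fin 3 :=
  if h : ∃ a b, V = {a, b} then
    if d h.choose.1 < d h.choose_spec.choose.1 then 0
    else if d h.choose.1 = d h.choose_spec.choose.1 then 1 else 2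
  else 0

-- The pair is unordered and `comparison` orders it by choice. Giving equality a value of its own
-- makes `≤` transfer whichever of the two points was chosen first.
open Classical in
lemma le_of_comparison_eq {X : Type*} {d d' : X → ℝ} {a b : X × Label}
    (h : comparison d' {a, b} = comparison d {a, b}) (hd : d a.1 ≤ d b.1) : d' a.1 ≤ d' b.1 := by
  have hex : ∃ a' b', ({a, b} : Finset (X × Label)) = {a', b'} := ⟨a, b, rfl⟩
  unfold comparison at h
  rw [dif_pos hex, dif_pos hex] at h
  have hor : (a = hex.choose ∧ b = hex.choose_spec.choose) ∨
      (a = hex.choose_spec.choose ∧ b = hex.choose) := by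
    have := congrArg (fun V : Finset (X × Label) => (V : Set (X × Label)))
      hex.choose_spec.choose_spec
    simpa only [Finset.coe_pair, Set.pair_eq_pair_iff] using this
  revert h hor
  generalize hex.choose_spec.choose = b'
  generalize hex.choose = a'
  intro h hor
  rcases hor with ⟨rfl, rfl⟩ | ⟨rfl, rfl⟩ <;> split_ifs at h <;>
    first
    | linarith
    | (exfalso; revert h; decide)
    | (rcases lt_trichotomy (d a.1) (d b.1) with h' | h' | h' <;>
        rcases lt_trichotomy (d' a.1) (d' b.1) with h'' | h'' | h'' <;> first | linarith | simp_all)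

theorem hasCertificateDimension_of_marginCertified {X : Type*} {cert : X → X → X → X → Prop}
    {C : Set (Concept X)} {d : Concept X → X → ℝ} (hd : ∀ h ∈ C, MarginCertified cert (d h) h)
    {s : Label → X} (hs : ∀ h ∈ C, ∀ y, h (s y) = y) : HasCertificateDimension C 3 7 3 := by
  classical
  refine ⟨by norm_num, by norm_num, fun h V => comparison (d h) V, fun h hh S hcard hS => ?_⟩
  -- This is where `m = 7` comes from: `7 > 2 * 3` forces four examples with one label.
  obtain ⟨y, -, hy⟩ : ∃ y ∈ (Finset.univ : Finset Label), 3 < (S.filter fun p => p.2 = y).card :=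
    Finset.exists_lt_card_fiber_of_mul_lt_card_of_maps_to (by simp) (by simp [hcard])
  obtain ⟨Q, hQ, hQ4⟩ := Finset.exists_subset_card_eq (Nat.succ_le_of_lt hy)
  let e := (Q.equivFinOfCardEq hQ4).symm
  have heS : ∀ i, (e i).1 ∈ S := fun i => (Finset.mem_filter.1 (hQ (e i).2)).1
  have hey : ∀ i, (e i).1.2 = y := fun i => (Finset.mem_filter.1 (hQ (e i).2)).2
  have heh : ∀ h' : Concept X, ∀ i, h' (e i).1.1 = (e i).1.2 → h' (e i).1.1 = y :=
    fun h' i hi => hi.trans (hey i)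
  have hne : ∀ i j, i ≠ j → (e i).1 ≠ (e j).1 := fun i j hij he =>
    hij (e.injective (Subtype.ext he))
  obtain ⟨p, q, r, hpq, hpr, hqr, hle, hc⟩ := (hd h hh).rich (s (!y)) (fun i => (e i).1.1)
    (fun i => by rw [heh h i (hS _ (heS i)), hs h hh]; cases y <;> decide)
  have hU : ({(e p).1, (e q).1, (e r).1} : Finset (X × Label)).erase (e p).1 = {(e q).1, (e r).1} :=
    Finset.erase_insert (by simp [hne _ _ hpq, hne _ _ hpr])
  refine ⟨{(e p).1, (e q).1, (e r).1}, ?_, Finset.card_eq_three.2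
    ⟨_, _, _, hne _ _ hpq, hne _ _ hpr, hne _ _ hqr, rfl⟩, (e p).1, by simp, fun h' hh' hσ => ?_⟩
  · simp [Finset.insert_subset_iff, heS]
  · rw [hU] at hσ
    have hq := heh h' q (hh'.2 _ (Finset.mem_erase.2 ⟨(hne _ _ hpq).symm, heS q⟩))
    have hr := heh h' r (hh'.2 _ (Finset.mem_erase.2 ⟨(hne _ _ hpr).symm, heS r⟩))
    have := (hd h' hh'.1).sound (s (!y)) _ _ _ (hq.trans hr.symm)
      (by rw [hq, hs h' hh'.1]; cases y <;> decide) (le_of_comparison_eq hσ hle) hc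
    have hp := hS _ (heS p)
    exact ⟨by rw [this, hq, hp, hey], hp⟩

theorem hasCertificateDimension_anchoredHalfspaces (sPos sNeg : Plane) :
    HasCertificateDimension (anchoredHalfspaces sPos sNeg) 3 7 3 := by
  classical
  -- The certificate may depend only on the concept, but different `(w, b)` with different margins
  -- define the same halfspace; one margin function per concept is therefore chosen.
  have hex : ∀ h ∈ anchoredHalfspaces sPos sNeg, ∃ d, MarginCertified Extends d h := by
    rintro h ⟨w, b, -, -, rfl⟩
    exact ⟨_, by simpa only [sub_eq_add_neg] using marginCertified_halfspace w (-b)⟩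
  refine hasCertificateDimension_of_marginCertified (cert := Extends)
    (d := fun h => if hh : ∃ d, MarginCertified Extends d h then hh.choose else 0)
    (fun h hh => ?_) (s := fun y => if y then sPos else sNeg) ?_
  · rw [dif_pos (hex h hh)]
    exact (hex h hh).choose_spec
  · rintro h ⟨w, b, h1, h2, rfl⟩ y
    cases y
    · simpa [sign_eq_false] using h2
    · simpa [sign_eq_true] using h1

/-! ### The learner -/

section Learner

variable {X : Type*} (cert : X → X → X → X → Prop)

/-- The examples `i` and `j`, anchored at the first example with a label other than that of `i`,
certify `x`. -/
def CertifiedBy {t : ℕ} (E : Fin t → X × Label) (i j : Fin t) (x : X) : Prop :=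
  ∃ k, (E k).2 ≠ (E i).2 ∧ (∀ u < k, (E u).2 = (E i).2) ∧ cert (E k).1 (E i).1 (E j).1 x

/-- The pair of examples `i`, `j` has never certified a wrong label. -/
def Reliable {t : ℕ} (E : Fin t → X × Label) (i j : Fin t) : Prop :=
  (E i).2 = (E j).2 ∧ ∀ u, CertifiedBy cert E i j (E u).1 → (E u).2 = (E i).2

open Classical in
/-- The number of reliable pairs of examples that certify the label `y` for `x`. -/
noncomputable def votes {t : ℕ} (E : Fin t → X × Label) (y : Label) (x : X) : ℕ :=
  (Finset.univ.filter fun p : Fin t × Fin t =>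
    (E p.1).2 = y ∧ Reliable cert E p.1 p.2 ∧ CertifiedBy cert E p.1 p.2 x).card

open Classical in
/-- Predict the only label seen so far as long as there is one; then predict a label that has
at least `α` votes, and abstain if there is none. -/
noncomputable def votePredict (α t : ℕ) (E : Fin t → X × Label) (x : X) : Prediction :=
  if ∀ u, (E u).2 = true then .label true
  else if ∀ u, (E u).2 = false then .label false
  else if α ≤ votes cert E true x then .label true
  else if α ≤ votes cert E false x then .label false
  else .abstain

variable [MeasurableSpace X] {cert}
  (hcert : MeasurableSet {p : X × X × X × X | cert p.1 p.2.1 p.2.2.1 p.2.2.2})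

include hcert

lemma measurable_certifiedBy {Y : Type*} [MeasurableSpace Y] {t : ℕ} {E : Y → Fin t → X × Label}
    (hE : Measurable E) (i j : Fin t) {x : Y → X} (hx : Measurable x) :
    Measurable fun y => CertifiedBy cert (E y) i j (x y) := by
  have hl : ∀ k, Measurable fun y => (E y k).2 := fun k => (hE.eval).snd
  have hp : ∀ k, Measurable fun y => (E y k).1 := fun k => (hE.eval).fst
  have heq : ∀ k, Measurable fun y => (E y k).2 = (E y i).2 := fun k =>
    measurableSet_setOfPred.1 (measurableSet_eq_fun (hl k) (hl i))
  refine Measurable.exists fun k => ((heq k).not).and ((Measurable.forall fun u =>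
    measurable_const.imp (heq u)).and ?_)
  exact measurableSet_setOfPred.1 (hcert.preimage
    ((hp k).prodMk ((hp i).prodMk ((hp j).prodMk hx))))

lemma measurable_votes {Y : Type*} [MeasurableSpace Y] {t : ℕ} {E : Y → Fin t → X × Label}
    (hE : Measurable E) (l : Label) {x : Y → X} (hx : Measurable x) :
    Measurable fun y => votes cert (E y) l (x y) := by
  classical
  have hl : ∀ k, Measurable fun y => (E y k).2 := fun k => (hE.eval).snd
  have hp : ∀ k, Measurable fun y => (E y k).1 := fun k => (hE.eval).fst
  unfold votes
  simp only [Finset.card_filter]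
  refine Finset.measurable_sum _ fun p _ => Measurable.ite (measurableSet_setOfPred.2 ?_)
    measurable_const measurable_const
  refine (measurableSet_setOfPred.1 (measurableSet_eq_fun (hl p.1) measurable_const)).and
    (Measurable.and ?_ (measurable_certifiedBy hcert hE _ _ hx))
  exact (measurableSet_setOfPred.1 (measurableSet_eq_fun (hl p.1) (hl p.2))).and
    (Measurable.forall fun u => (measurable_certifiedBy hcert hE _ _ (hp u)).imp
      (measurableSet_setOfPred.1 (measurableSet_eq_fun (hl u) (hl p.1))))

/-- The learner that predicts by `votePredict` with the threshold `α`. -/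
noncomputable def voteLearner (α : ℕ) : Learner X where
  predict := votePredict cert α
  measurable_predict t := by
    classical
    have hl : ∀ k (l : Label), Measurable fun p : (Fin t → X × Label) × X => (p.1 k).2 = l :=
      fun k l => measurableSet_setOfPred.1
        (measurableSet_eq_fun (measurable_fst.eval).snd measurable_const)
    have hv : ∀ l : Label, MeasurableSet
        {p : (Fin t → X × Label) × X | α ≤ votes cert p.1 l p.2} := fun l =>
      measurableSet_le measurable_const (measurable_votes hcert measurable_fst l measurable_snd)
    exact Measurable.ite (measurableSet_setOfPred.2 (Measurable.forall fun u => hl u true))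
      measurable_const <|
      Measurable.ite (measurableSet_setOfPred.2 (Measurable.forall fun u => hl u false))
        measurable_const <|
      Measurable.ite (hv true) measurable_const <|
      Measurable.ite (hv false) measurable_const measurable_const

end Learner

/-! ### The rounds of the protocol as an infinite sequence -/

section Play

variable {Ω X : Type*} [MeasurableSpace Ω] [MeasurableSpace X]

/-- The round number `t` of the protocol. -/
def play (L : Learner X) (c : Concept X) (A : Adversary Ω X) (ω : Ω) (z : ℕ → X) (t : ℕ) :
    Round X :=
  playRound L c A ω (z t) t (record L c A ω z t)

variable {L : Learner X} {c : Concept X} {A : Adversary Ω X} {ω : Ω} {z : ℕ → X}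

lemma record_apply {t : ℕ} (s : Fin t) : record L c A ω z t s = play L c A ω z s := by
  induction t with
  | zero => exact s.elim0
  | succ t ih =>
    induction s using Fin.lastCases with
    | last => simp [record, play]
    | cast s => simp [record, ih]

lemma play_label (t : ℕ) : (play L c A ω z t).2.2.2 = c (play L c A ω z t).1 := rfl

lemma play_prediction (t : ℕ) : (play L c A ω z t).2.2.1 = L.predict t
    (fun s : Fin t => ((play L c A ω z s).1, c (play L c A ω z s).1)) (play L c A ω z t).1 := by
  conv_lhs => rw [play]
  simp only [playRound, record_apply, play_label]
  rfl

lemma play_bit (t : ℕ) : (play L c A ω z t).2.1 = A.bit t ω (record L c A ω z t) := rfl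

lemma play_instance (t : ℕ) : (play L c A ω z t).1 =
    if A.bit t ω (record L c A ω z t) = true then A.inject t ω (record L c A ω z t) else z t := rfl

lemma record_congr {z' : ℕ → X} {t : ℕ} (h : ∀ s < t, z s = z' s) :
    record L c A ω z t = record L c A ω z' t := by
  induction t with
  | zero => rfl
  | succ t ih => rw [record, record, ih fun s hs => h s (hs.trans t.lt_succ_self), h t t.lt_succ_self]

lemma play_congr {z' : ℕ → X} {t : ℕ} (h : ∀ s ≤ t, z s = z' s) :
    play L c A ω z t = play L c A ω z' t := by
  rw [play, play, record_congr fun s hs => h s hs.le, h t le_rfl]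

lemma measurable_record (hc : Measurable c) (t : ℕ) :
    Measurable fun p : Ω × (ℕ → X) => record L c A p.1 p.2 t := by
  induction t with
  | zero => exact measurable_pi_iff.2 fun s => s.elim0
  | succ t ih =>
    have hq : Measurable fun p : Ω × (ℕ → X) => A.bit t p.1 (record L c A p.1 p.2 t) :=
      (A.measurable_bit t).comp (measurable_fst.prodMk ih)
    have hx : Measurable fun p : Ω × (ℕ → X) =>
        if A.bit t p.1 (record L c A p.1 p.2 t) = true then
          A.inject t p.1 (record L c A p.1 p.2 t) else p.2 t :=
      Measurable.ite (measurableSet_eq_fun hq measurable_const)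
        ((A.measurable_inject t).comp (measurable_fst.prodMk ih)) measurable_snd.eval
    refine measurable_pi_iff.2 fun s => ?_
    induction s using Fin.lastCases with
    | last =>
      simp only [record, Fin.snoc_last, playRound]
      refine hx.prodMk (hq.prodMk (Measurable.prodMk ?_ (hc.comp hx)))
      exact (L.measurable_predict t).comp ((measurable_pi_iff.2 fun s =>
        (ih.eval).fst.prodMk (ih.eval).snd.snd.snd).prodMk hx)
    | cast s => simpa only [record, Fin.snoc_castSucc] using ih.eval

lemma measurable_play (hc : Measurable c) (t : ℕ) :
    Measurable fun p : Ω × (ℕ → X) => play L c A p.1 p.2 t := by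
  have := (measurable_pi_iff.1 (measurable_record (L := L) (A := A) hc (t + 1))) (Fin.last t)
  simpa only [record_apply, Fin.val_last] using this

open Classical in
lemma errMis_record (T : ℕ) : errMis (record L c A ω z T) = ((Finset.range T).filter fun t =>
    ∃ y, (play L c A ω z t).2.2.1 = Prediction.label y ∧ y ≠ c (play L c A ω z t).1).card := by
  classical
  simp only [errMis, record_apply]
  rw [Fin.sum_univ_eq_sum_range (fun t => if (play L c A ω z t).2.2.1 ≠
    Prediction.label (play L c A ω z t).2.2.2 ∧ (play L c A ω z t).2.2.1 ≠ Prediction.abstain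
    then (1 : ℝ) else 0), Finset.sum_boole]
  congr 2
  refine Finset.filter_congr fun t _ => ?_
  rw [play_label]
  cases (play L c A ω z t).2.2.1 <;> simp

open Classical in
lemma errAbs_record (T : ℕ) : errAbs (record L c A ω z T) = ((Finset.range T).filter fun t =>
    (play L c A ω z t).2.2.1 = Prediction.abstain ∧ (play L c A ω z t).2.1 = false).card := by
  classical
  simp only [errAbs, record_apply]
  rw [Fin.sum_univ_eq_sum_range (fun t => if (play L c A ω z t).2.2.1 = Prediction.abstain ∧
    (play L c A ω z t).2.1 = false then (1 : ℝ) else 0), Finset.sum_boole]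

end Play

/-! ### The number of mistakes -/

section Mistakes

variable {X : Type*} {cert : X → X → X → X → Prop} {c : Concept X} {x : ℕ → X}

/-- The first `t` labeled examples of a sequence of instances. -/
def examples (c : Concept X) (x : ℕ → X) (t : ℕ) : Fin t → X × Label :=
  fun s => (x s, c (x s))

/-- The anchor is the first example with the other label, so later examples do not change it. Hence
an error of a pair is never forgotten. -/
lemma CertifiedBy.mono {s t : ℕ} (hst : s ≤ t) {i j : Fin s} {z : X}
    (h : CertifiedBy cert (examples c x s) i j z) :
    CertifiedBy cert (examples c x t) (i.castLE hst) (j.castLE hst) z := by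
  obtain ⟨k, h1, h2, h3⟩ := h
  exact ⟨k.castLE hst, h1, fun u hu => h2 ⟨u, lt_of_lt_of_le hu k.2.le⟩ hu, h3⟩

/-- After the first mistake of this kind a label other than `y` has been seen. -/
lemma card_unanimous_mistakes_le (y : Label) (T : ℕ) :
    ((Finset.range T).filter fun t => (∀ u < t, c (x u) = y) ∧ c (x t) ≠ y).card ≤ 1 := by
  refine Finset.card_le_one.2 fun s hs t ht => ?_
  simp only [Finset.mem_filter] at hs ht
  by_contra hne
  rcases lt_or_gt_of_ne hne with h | h
  · exact hs.2.2 (ht.2.1 s h)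
  · exact ht.2.2 (hs.2.1 t h)

/-- The reliable pairs of examples that certify a wrong label in round `t`. -/
def MisledPair (cert : X → X → X → X → Prop) (c : Concept X) (x : ℕ → X) (t : ℕ) (p : ℕ × ℕ) :
    Prop :=
  ∃ (hi : p.1 < t) (hj : p.2 < t), c (x p.1) ≠ c (x t) ∧
    Reliable cert (examples c x t) ⟨p.1, hi⟩ ⟨p.2, hj⟩ ∧
    CertifiedBy cert (examples c x t) ⟨p.1, hi⟩ ⟨p.2, hj⟩ (x t)

lemma MisledPair.not_of_lt {s t : ℕ} (hst : s < t) {p : ℕ × ℕ} (hs : MisledPair cert c x s p)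
    (ht : MisledPair cert c x t p) : False := by
  obtain ⟨hi, hj, h1, h2, h3⟩ := hs
  obtain ⟨hi', hj', -, h2', -⟩ := ht
  exact h1 (h2'.2 ⟨s, hst⟩ (h3.mono hst.le)).symm

/-- Double counting: the sets of pairs misled in different rounds are disjoint, because a misled
pair is unreliable from then on. -/
lemma card_misled_mul_le (α T : ℕ) : ((Finset.range T).filter fun t =>
    ∃ y, y ≠ c (x t) ∧ α ≤ votes cert (examples c x t) y (x t)).card * α ≤ T ^ 2 := by
  classical
  set M := (Finset.range T).filter fun t =>
    ∃ y, y ≠ c (x t) ∧ α ≤ votes cert (examples c x t) y (x t)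
  set K : ℕ → Finset (ℕ × ℕ) := fun t =>
    (Finset.range T ×ˢ Finset.range T).filter (MisledPair cert c x t)
  have hK : ∀ t ∈ M, α ≤ (K t).card := by
    intro t ht
    obtain ⟨htT, y, hy, hα⟩ := Finset.mem_filter.1 ht
    refine hα.trans (Finset.card_le_card_of_injOn (fun p => (p.1.1, p.2.1)) ?_ ?_)
    · intro p hp
      obtain ⟨-, h1, h2, h3⟩ := Finset.mem_filter.1 hp
      have hT := Finset.mem_range.1 htT
      exact Finset.mem_filter.2 ⟨by simp [p.1.2.trans hT, p.2.2.trans hT], p.1.2, p.2.2,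
        fun h => hy (h1.symm.trans h), h2, h3⟩
    · rintro ⟨p, q⟩ - ⟨p', q'⟩ - h
      simpa [Fin.ext_iff] using h
  calc M.card * α = ∑ _t ∈ M, α := by simp
    _ ≤ ∑ t ∈ M, (K t).card := Finset.sum_le_sum hK
    _ = (M.biUnion K).card := by
        refine (Finset.card_biUnion fun s _ t _ hne => Finset.disjoint_left.2 fun p hs ht => ?_).symm
        have hs' := (Finset.mem_filter.1 hs).2
        have ht' := (Finset.mem_filter.1 ht).2
        rcases lt_or_gt_of_ne hne with h | h
        · exact hs'.not_of_lt h ht'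
        · exact ht'.not_of_lt h hs'
    _ ≤ (Finset.range T ×ˢ Finset.range T).card := Finset.card_le_card
        (Finset.biUnion_subset.2 fun t _ => Finset.filter_subset _ _)
    _ = T ^ 2 := by simp [sq]

open Classical in
theorem card_mistakes_le {α : ℕ} (hα : 0 < α) (T : ℕ) : (((Finset.range T).filter fun t =>
    ∃ y, votePredict cert α t (examples c x t) (x t) = Prediction.label y ∧ y ≠ c (x t)).card : ℝ) ≤
      2 + (T : ℝ) ^ 2 / α := by
  classical
  have hsub : ((Finset.range T).filter fun t =>
      ∃ y, votePredict cert α t (examples c x t) (x t) = Prediction.label y ∧ y ≠ c (x t)) ⊆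
      (((Finset.range T).filter fun t => (∀ u < t, c (x u) = true) ∧ c (x t) ≠ true) ∪
      ((Finset.range T).filter fun t => (∀ u < t, c (x u) = false) ∧ c (x t) ≠ false)) ∪
      (Finset.range T).filter fun t =>
        ∃ y, y ≠ c (x t) ∧ α ≤ votes cert (examples c x t) y (x t) := by
    intro t ht
    obtain ⟨htT, y, hp, hy⟩ := Finset.mem_filter.1 ht
    unfold votePredict at hp
    simp only [Finset.mem_union, Finset.mem_filter, htT, true_and]
    split_ifs at hp with h1 h2 h3 h4 <;> cases hp
    · exact .inl (.inl ⟨fun u hu => h1 ⟨u, hu⟩, hy.symm⟩)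
    · exact .inl (.inr ⟨fun u hu => h2 ⟨u, hu⟩, hy.symm⟩)
    · exact .inr ⟨_, hy, h3⟩
    · exact .inr ⟨_, hy, h4⟩
  have h1 := (Finset.card_le_card hsub).trans ((Finset.card_union_le _ _).trans
    (Nat.add_le_add_right ((Finset.card_union_le _ _).trans
      (add_le_add (card_unanimous_mistakes_le true T) (card_unanimous_mistakes_le false T))) _))
  have h2 := card_misled_mul_le (cert := cert) (c := c) (x := x) α T
  set M := (Finset.range T).filter fun t =>
    ∃ y, y ≠ c (x t) ∧ α ≤ votes cert (examples c x t) y (x t)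
  have h3 : (M.card : ℝ) ≤ (T : ℝ) ^ 2 / α := by
    rw [le_div_iff₀ (by exact_mod_cast hα)]
    exact_mod_cast h2
  have h4 : (((Finset.range T).filter fun t =>
      ∃ y, votePredict cert α t (examples c x t) (x t) = Prediction.label y ∧ y ≠ c (x t)).card : ℝ) ≤
      1 + 1 + M.card := by exact_mod_cast h1
  linarith

open Classical in
/-- When the learner abstains, both labels have been seen, and few pairs of examples certify the
instance. -/
theorem card_lt_of_abstain {α t : ℕ} {d : X → ℝ} (hd : MarginCertified cert d c)
    (h : votePredict cert α t (examples c x t) (x t) = .abstain) :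
    (∀ y, ∃ u < t, c (x u) = y) ∧ ∀ s, (∃ k < t, s = x k ∧ c (x k) ≠ c (x t) ∧
      ∀ u < k, c (x u) = c (x t)) → ((Finset.range t ×ˢ Finset.range t).filter fun p : ℕ × ℕ =>
      c (x p.1) = c (x t) ∧ c (x p.2) = c (x t) ∧ d (x p.1) ≤ d (x p.2) ∧
        cert s (x p.1) (x p.2) (x t)).card < α := by
  unfold votePredict at h
  split_ifs at h with h1 h2 h3 h4
  refine ⟨?_, ?_⟩
  · rintro (_ | _)
    · push Not at h1
      obtain ⟨u, hu⟩ := h1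
      exact ⟨u, u.2, by simpa [examples] using hu⟩
    · push Not at h2
      obtain ⟨u, hu⟩ := h2
      exact ⟨u, u.2, by simpa [examples] using hu⟩
  · rintro s ⟨k, hk, rfl, hk1, hk2⟩
    have hv : votes cert (examples c x t) (c (x t)) (x t) < α := by
      cases c (x t)
      · exact not_le.1 h4
      · exact not_le.1 h3
    refine lt_of_le_of_lt ?_ hv
    -- Each such pair is a vote for the true label: soundness with the true margins shows that it
    -- has never erred. The value `(k, k)` is only a default outside the range.
    refine Finset.card_le_card_of_injOn
      (fun p => if hp : p.1 < t ∧ p.2 < t then (⟨p.1, hp.1⟩, ⟨p.2, hp.2⟩) else (⟨k, hk⟩, ⟨k, hk⟩))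
      ?_ ?_
    · rintro ⟨i, j⟩ hp
      simp only [Finset.coe_filter, Finset.mem_product, Finset.mem_range, Set.mem_ofPred_eq] at hp
      obtain ⟨hij, hi, hj, hdij, hc⟩ := hp
      beta_reduce
      rw [dif_pos hij]
      refine Finset.mem_filter.2 ⟨Finset.mem_univ _, hi, ⟨hi.trans hj.symm, ?_⟩, ?_⟩
      · rintro u ⟨k', hk', -, hc'⟩
        exact hd.sound _ _ _ _ (hi.trans hj.symm) hk' hdij hc'
      · refine ⟨⟨k, hk⟩, ?_, fun u hu => ?_, hc⟩
        · change c (x k) ≠ c (x i)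
          rwa [hi]
        · change c (x u) = c (x i)
          rw [hi]
          exact hk2 u hu
    · rintro ⟨i, j⟩ hp ⟨i', j'⟩ hp' h
      simp only [Finset.coe_filter, Finset.mem_product, Finset.mem_range, Set.mem_ofPred_eq] at hp hp'
      dsimp only at h
      rw [dif_pos hp.1, dif_pos hp'.1] at h
      simpa using h

end Mistakes

/-! ### Resampling and permuting the coordinates of an infinite product -/

section InfinitePi

variable {X : Type*} [MeasurableSpace X] (D : Measure X) [IsProbabilityMeasure D]

/-- Replacing one coordinate by an independent copy preserves the product law, as one checks on
boxes. This takes the place of conditioning on the earlier rounds. -/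
lemma lintegral_infinitePi_update (t : ℕ) {G : (ℕ → X) → ENNReal} (hG : Measurable G) :
    ∫⁻ z, G z ∂(Measure.infinitePi fun _ : ℕ => D) =
      ∫⁻ z, ∫⁻ a, G (Function.update z t a) ∂D ∂(Measure.infinitePi fun _ : ℕ => D) := by
  classical
  set P := Measure.infinitePi fun _ : ℕ => D
  have hu : Measurable fun p : (ℕ → X) × X => Function.update p.1 t p.2 := measurable_update'
  have hmap : (P.prod D).map (fun p : (ℕ → X) × X => Function.update p.1 t p.2) = P := by
    refine Measure.eq_infinitePi _ fun s B hB => ?_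
    rw [Measure.map_apply hu (.pi s.countable_toSet fun i _ => hB i)]
    have hpre : (fun p : (ℕ → X) × X => Function.update p.1 t p.2) ⁻¹' (Set.pi s B) =
        (Set.pi (s.erase t : Finset ℕ) B) ×ˢ (if t ∈ s then B t else Set.univ) := by
      ext ⟨z, a⟩
      simp only [Set.mem_preimage, Set.mem_pi, Finset.mem_coe, Set.mem_prod, Finset.mem_erase]
      constructor
      · intro h
        refine ⟨fun i hi => by simpa [Function.update_of_ne hi.1] using h i hi.2, ?_⟩
        split_ifs with ht
        · simpa using h t ht
        · trivial
      · rintro ⟨h1, h2⟩ i hi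
        rcases eq_or_ne i t with rfl | hne
        · simpa [hi] using h2
        · simpa [Function.update_of_ne hne] using h1 i ⟨hne, hi⟩
    rw [hpre, Measure.prod_prod, Measure.infinitePi_pi _ fun i _ => hB i]
    split_ifs with ht
    · exact Finset.prod_erase_mul _ _ ht
    · rw [measure_univ, mul_one, Finset.erase_eq_of_notMem ht]
  conv_lhs => rw [← hmap, lintegral_map hG hu]
  exact lintegral_prod _ (hG.comp hu).aemeasurable

lemma lintegral_infinitePi_perm (e : Equiv.Perm ℕ) {G : (ℕ → X) → ENNReal} (hG : Measurable G) :
    ∫⁻ z, G (z ∘ e) ∂(Measure.infinitePi fun _ : ℕ => D) =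
      ∫⁻ z, G z ∂(Measure.infinitePi fun _ : ℕ => D) := by
  have h : (Measure.infinitePi fun _ : ℕ => D).map (fun z => z ∘ e) =
      Measure.infinitePi fun _ : ℕ => D :=
    Measure.map_infinitePi_infinitePi_of_inj e.injective
  conv_rhs => rw [← h, lintegral_map hG (measurable_pi_iff.2 fun i => measurable_pi_apply _)]

end InfinitePi

/-! ### The leave-one-out bound -/

section LeaveOneOut

variable {X : Type*} {cert : X → X → X → X → Prop} {c : Concept X} {d : X → ℝ}

open Classical in
/-- If each point of a family of points with the same label is certified by fewer than `α` pairs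
of others, then the family has `O(√α)` elements. -/
theorem card_le_of_forall_card_certifying_lt (hd : MarginCertified cert d c) {s : X} {v : ℕ → X}
    {J : Finset ℕ} {α : ℕ} {y : Label} (hs : c s ≠ y) (hJ : ∀ j ∈ J, c (v j) = y)
    (hα : ∀ j ∈ J, ((J.erase j ×ˢ J.erase j).filter fun p : ℕ × ℕ =>
      d (v p.1) ≤ d (v p.2) ∧ cert s (v p.1) (v p.2) (v j)).card < α) :
    (J.card : ℝ) ≤ 6 + 10 * √α := by
  set K : ℕ → Finset (ℕ × ℕ) := fun j => (J.erase j ×ˢ J.erase j).filter fun p : ℕ × ℕ =>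
      d (v p.1) ≤ d (v p.2) ∧ cert s (v p.1) (v p.2) (v j)
  -- Each four-element subset is encoded by a certified point, the pair certifying it and the
  -- remaining point. The code determines the subset, and there are at most `n * α * n` codes.
  have key : ∀ Q : Finset ℕ, ∃ f : (Σ _ : ℕ, ℕ × ℕ) × ℕ, Q ∈ J.powersetCard 4 →
      f ∈ (J.sigma K) ×ˢ J ∧ Q = {f.1.1, f.1.2.1, f.1.2.2, f.2} := by
    intro Q
    by_cases hQ : Q ∈ J.powersetCard 4
    swap
    · exact ⟨⟨⟨0, 0, 0⟩, 0⟩, fun h => absurd h hQ⟩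
    obtain ⟨hQJ, hQ4⟩ := Finset.mem_powersetCard.1 hQ
    let e := (Q.equivFinOfCardEq hQ4).symm
    have heJ : ∀ i, (e i).1 ∈ J := fun i => hQJ (e i).2
    have hne : ∀ i j, i ≠ j → (e i).1 ≠ (e j).1 := fun i j hij he =>
      hij (e.injective (Subtype.ext he))
    obtain ⟨p, q, r, hpq, hpr, hqr, hle, hc⟩ := hd.rich s (fun i => v (e i).1)
      (fun i => by rw [hJ _ (heJ i)]; exact hs.symm)
    obtain ⟨m, hm⟩ : ∃ m : Fin 4, ∀ i, i = p ∨ i = q ∨ i = r ∨ i = m := by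
      clear hle hc
      revert p q r
      decide
    refine ⟨⟨⟨(e p).1, (e q).1, (e r).1⟩, (e m).1⟩, fun _ => ⟨?_, ?_⟩⟩
    · refine Finset.mem_product.2 ⟨Finset.mem_sigma.2 ⟨heJ p, Finset.mem_filter.2 ⟨?_, hle, hc⟩⟩,
        heJ m⟩
      simp [heJ, (hne _ _ hpq).symm, (hne _ _ hpr).symm]
    · ext a
      simp only [Finset.mem_insert, Finset.mem_singleton]
      constructor
      · intro ha
        have hi := hm (e.symm ⟨a, ha⟩)
        simp only [Equiv.symm_apply_eq, Subtype.ext_iff] at hi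
        exact hi
      · rintro (rfl | rfl | rfl | rfl) <;> exact (e _).2
  choose f hf using key
  have h1 : (J.powersetCard 4).card ≤ ((J.sigma K) ×ˢ J).card := by
    refine Finset.card_le_card_of_injOn f (fun Q hQ => (hf Q hQ).1) fun Q hQ Q' hQ' h => ?_
    rw [(hf Q hQ).2, (hf Q' hQ').2, h]
  have h2 : ((J.sigma K) ×ˢ J).card ≤ J.card * α * J.card := by
    rw [Finset.card_product, Finset.card_sigma]
    refine Nat.mul_le_mul_right _ ((Finset.sum_le_sum fun j hj => (hα j hj).le).trans ?_)
    simp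
  rw [Finset.card_powersetCard] at h1
  by_contra! hlt
  have hsq : 0 ≤ √(α : ℝ) := Real.sqrt_nonneg _
  have hsq2 : √(α : ℝ) ^ 2 = α := Real.sq_sqrt (Nat.cast_nonneg _)
  have hn : 6 < J.card := by exact_mod_cast (show (6 : ℝ) < J.card by linarith)
  have h3 := Nat.pow_le_choose (α := ℝ) 4 J.card
  have h4 : ((J.card + 1 - 4 : ℕ) : ℝ) = J.card - 3 := by
    rw [Nat.cast_sub (by omega)]; push_cast; ring
  have h5 : (J.card.choose 4 : ℝ) ≤ J.card * α * J.card := by exact_mod_cast h1.trans h2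
  rw [h4, show (Nat.factorial 4 : ℝ) = 24 by norm_num [Nat.factorial]] at h3
  set n : ℝ := (J.card : ℝ)
  -- From `n > 6 + 10√α` follow `n ≤ 2 (n - 3)` and `100 α < (n - 3) ^ 2`, whereas the count yields
  -- `(n - 3) ^ 2 ≤ 96 α`.
  have h6 : (n - 3) ^ 4 ≤ 24 * (n * α * n) := by linarith
  have h7 : 10 * √(α : ℝ) < n - 3 := by linarith
  have h8 : n ≤ 2 * (n - 3) := by linarith
  have h9 : n * n ≤ 4 * (n - 3) ^ 2 := by nlinarith
  have h10 : 100 * (α : ℝ) < (n - 3) ^ 2 := by nlinarith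
  have h11 : n * α * n ≤ 4 * (n - 3) ^ 2 * α := by
    nlinarith [mul_le_mul_of_nonneg_right h9 (Nat.cast_nonneg (α := ℝ) α)]
  have h12 : 0 < (n - 3) ^ 2 := by nlinarith
  nlinarith [mul_lt_mul_of_pos_left h10 h12]

open Classical in
/-- The number of pairs among the first `i` points of `l` that certify the label of `z` with the
anchor `s`. -/
noncomputable def certCount (cert : X → X → X → X → Prop) (c : Concept X) (d : X → ℝ) (s : X)
    (i : ℕ) (l : ℕ → X) (z : X) : ℕ :=
  ((Finset.range i ×ˢ Finset.range i).filter fun p : ℕ × ℕ =>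
    c (l p.1) = c z ∧ c (l p.2) = c z ∧ d (l p.1) ≤ d (l p.2) ∧ cert s (l p.1) (l p.2) z).card

/-- The indicator that fewer than `α` pairs among the first `i` points of `l` certify `z`. -/
noncomputable def uncertified (cert : X → X → X → X → Prop) (c : Concept X) (d : X → ℝ) (α : ℕ)
    (s : Label → X) (i : ℕ) (l : ℕ → X) (z : X) : ENNReal :=
  if certCount cert c d (s (!c z)) i l z < α then 1 else 0

lemma uncertified_congr {α i : ℕ} {s : Label → X} {l l' : ℕ → X} (h : ∀ j < i, l j = l' j) (z : X) :
    uncertified cert c d α s i l z = uncertified cert c d α s i l' z := by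
  classical
  unfold uncertified certCount
  have hf := Finset.filter_congr (s := Finset.range i ×ˢ Finset.range i)
    (p := fun p : ℕ × ℕ => c (l p.1) = c z ∧ c (l p.2) = c z ∧ d (l p.1) ≤ d (l p.2) ∧
      cert (s (!c z)) (l p.1) (l p.2) z)
    (q := fun p : ℕ × ℕ => c (l' p.1) = c z ∧ c (l' p.2) = c z ∧ d (l' p.1) ≤ d (l' p.2) ∧
      cert (s (!c z)) (l' p.1) (l' p.2) z) fun p hp => ?_
  · rw [hf]
  simp only [Finset.mem_product, Finset.mem_range] at hp
  rw [h _ hp.1, h _ hp.2]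

/-- The swap of `j` and `N` makes `l j` the last point, to be certified by the other `N`. The
uncertified points of either label satisfy the leave-one-out bound, since restricting to pairs among
them only lowers the counts; two labels double the constant. -/
lemma sum_uncertified_swap_le (hd : MarginCertified cert d c) {s : Label → X}
    (hs : ∀ y, c (s y) = y) (α N : ℕ) (l : ℕ → X) :
    ∑ j ∈ Finset.range (N + 1), uncertified cert c d α s N (l ∘ Equiv.swap j N) (l j) ≤
      ENNReal.ofReal (12 + 20 * √α) := by
  classical
  unfold uncertified
  rw [Finset.sum_boole]
  set B := (Finset.range (N + 1)).filter fun j =>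
    certCount cert c d (s (!c (l j))) N (l ∘ Equiv.swap j N) (l j) < α
  have hB : ∀ y, ((B.filter fun j => c (l j) = y).card : ℝ) ≤ 6 + 10 * √α := by
    intro y
    refine card_le_of_forall_card_certifying_lt hd (s := s (!y)) (v := l) (y := y)
      (by rw [hs]; cases y <;> decide) (fun j hj => (Finset.mem_filter.1 hj).2) fun j hj => ?_
    obtain ⟨hjB, hjy⟩ := Finset.mem_filter.1 hj
    obtain ⟨hjN, hlt⟩ := Finset.mem_filter.1 hjB
    rw [hjy] at hlt
    refine lt_of_le_of_lt (Finset.card_le_card_of_injOn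
      (fun p => (Equiv.swap j N p.1, Equiv.swap j N p.2)) ?_ ?_) hlt
    · have hlt : ∀ a, a < N + 1 → a ≠ j → Equiv.swap j N a < N := by
        intro a ha haj
        rw [Finset.mem_range] at hjN
        rcases eq_or_ne a N with rfl | h
        · rw [Equiv.swap_apply_right]; omega
        · rw [Equiv.swap_apply_of_ne_of_ne haj h]; omega
      rintro ⟨a, b⟩ hp
      obtain ⟨hab, h1, h2⟩ := Finset.mem_filter.1 hp
      obtain ⟨ha, hb⟩ := Finset.mem_product.1 hab
      obtain ⟨haj, ha⟩ := Finset.mem_erase.1 ha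
      obtain ⟨hbj, hb⟩ := Finset.mem_erase.1 hb
      obtain ⟨haB, hay⟩ := Finset.mem_filter.1 ha
      obtain ⟨hbB, hby⟩ := Finset.mem_filter.1 hb
      have haN := Finset.mem_range.1 (Finset.mem_filter.1 haB).1
      have hbN := Finset.mem_range.1 (Finset.mem_filter.1 hbB).1
      refine Finset.mem_filter.2 ⟨by simp [hlt a haN haj, hlt b hbN hbj], ?_⟩
      simp only [Function.comp, Equiv.swap_apply_self, hay, hby, hjy, true_and]
      exact ⟨h1, h2⟩
    · rintro ⟨a, b⟩ - ⟨a', b'⟩ - h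
      simpa using h
  have hsum : B.card = (B.filter fun j => c (l j) = true).card +
      (B.filter fun j => c (l j) = false).card := by
    rw [← Finset.card_filter_add_card_filter_not (s := B) (fun j => c (l j) = true)]
    simp
  rw [← ENNReal.ofReal_natCast]
  refine ENNReal.ofReal_le_ofReal ?_
  rw [hsum]
  push_cast
  linarith [hB true, hB false]

end LeaveOneOut

/-! ### Measurability -/

section Measurability

variable {X : Type*} [MeasurableSpace X] {cert : X → X → X → X → Prop} {c : Concept X} {d : X → ℝ}
  (hcert : MeasurableSet {p : X × X × X × X | cert p.1 p.2.1 p.2.2.1 p.2.2.2})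
  (hc : Measurable c) (hdm : Measurable d)

include hc in
lemma measurable_apply_not_label {Y : Type*} [MeasurableSpace Y] {s : Y → Label → X} {z : Y → X}
    (hs : Measurable s) (hz : Measurable z) : Measurable fun y => s y (!c (z y)) := by
  have : (fun y => s y (!c (z y))) = fun y => if c (z y) = true then s y false else s y true := by
    funext y
    cases c (z y) <;> simp
  rw [this]
  exact Measurable.ite (measurableSet_eq_fun (hc.comp hz) measurable_const) hs.eval hs.eval

include hcert hc hdm in
lemma measurable_uncertified {Y : Type*} [MeasurableSpace Y] {s : Y → Label → X} {l : Y → ℕ → X}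
    {z : Y → X} (hs : Measurable s) (hl : Measurable l) (hz : Measurable z) (α i : ℕ) :
    Measurable fun y => uncertified cert c d α (s y) i (l y) (z y) := by
  classical
  have hli : ∀ j, Measurable fun y => l y j := fun j => hl.eval
  have hcz : ∀ j, Measurable fun y => c (l y j) = c (z y) := fun j =>
    measurableSet_setOfPred.1 (measurableSet_eq_fun (hc.comp (hli j)) (hc.comp hz))
  have hcount : Measurable fun y => certCount cert c d (s y (!c (z y))) i (l y) (z y) := by
    unfold certCount
    simp only [Finset.card_filter]
    refine Finset.measurable_sum _ fun p _ => Measurable.ite (measurableSet_setOfPred.2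
      ((hcz _).and ((hcz _).and (Measurable.and ?_ ?_)))) measurable_const measurable_const
    · exact measurableSet_setOfPred.1 (measurableSet_le (hdm.comp (hli _)) (hdm.comp (hli _)))
    · exact measurableSet_setOfPred.1 (hcert.preimage
        ((measurable_apply_not_label hc hs hz).prodMk ((hli _).prodMk ((hli _).prodMk hz))))
  exact Measurable.ite (measurableSet_lt hcount measurable_const) measurable_const measurable_const

end Measurability

/-! ### Expected future abstentions -/

section Potential

variable {X : Type*} [MeasurableSpace X] (cert : X → X → X → X → Prop) (c : Concept X) (d : X → ℝ)
  (α : ℕ) (D : Measure X)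

/-- The expected number of uncertified points among `n` fresh draws, each of them to be certified
by the preceding draws, the first `i` of which are given by `l`. -/
noncomputable def expectedUncertified : ℕ → (Label → X) → ℕ → (ℕ → X) → ENNReal
  | 0, _, _, _ => 0
  | n + 1, s, i, l => ∫⁻ z, uncertified cert c d α s i l z +
      expectedUncertified n s (i + 1) (Function.update l i z) ∂D

variable {cert c d α D}

lemma expectedUncertified_congr {n i : ℕ} {s : Label → X} {l l' : ℕ → X}
    (h : ∀ j < i, l j = l' j) :
    expectedUncertified cert c d α D n s i l = expectedUncertified cert c d α D n s i l' := by
  induction n generalizing i l l' with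
  | zero => rfl
  | succ n ih =>
    refine lintegral_congr fun z => ?_
    rw [uncertified_congr h, ih fun j hj => ?_]
    rcases eq_or_ne j i with rfl | hne
    · simp
    · simpa [Function.update_of_ne hne] using h j (by omega)

lemma expectedUncertified_le_succ (n : ℕ) (s : Label → X) (i : ℕ) (l : ℕ → X) :
    expectedUncertified cert c d α D n s i l ≤ expectedUncertified cert c d α D (n + 1) s i l := by
  induction n generalizing i l with
  | zero => exact zero_le
  | succ n ih => exact lintegral_mono fun z => add_le_add le_rfl (ih _ _)

variable (hcert : MeasurableSet {p : X × X × X × X | cert p.1 p.2.1 p.2.2.1 p.2.2.2})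
  (hc : Measurable c) (hdm : Measurable d)

include hcert hc hdm

lemma measurable_expectedUncertified [SFinite D] (n i : ℕ) :
    Measurable fun p : (Label → X) × (ℕ → X) =>
      expectedUncertified cert c d α D n p.1 i p.2 := by
  induction n generalizing i with
  | zero => exact measurable_const
  | succ n ih =>
    have hu : Measurable fun p : ((Label → X) × (ℕ → X)) × X => Function.update p.1.2 i p.2 :=
      (measurable_update' (a := i)).comp (measurable_fst.snd.prodMk measurable_snd)
    exact Measurable.lintegral_prod_right' (f := fun p : ((Label → X) × (ℕ → X)) × X =>
      uncertified cert c d α p.1.1 i p.1.2 p.2 +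
        expectedUncertified cert c d α D n p.1.1 (i + 1) (Function.update p.1.2 i p.2))
      ((measurable_uncertified hcert hc hdm measurable_fst.fst measurable_fst.snd
        measurable_snd α i).add ((ih (i + 1)).comp (measurable_fst.fst.prodMk hu)))

variable [IsProbabilityMeasure D]

/-- Exchangeability: each of the `N + 1` points is equally likely to be the uncertified last one, so
the pointwise bound on the sum is divided by `N + 1`. -/
lemma lintegral_uncertified_le (hd : MarginCertified cert d c) {s : Label → X}
    (hs : ∀ y, c (s y) = y) (N : ℕ) :
    ∫⁻ z, uncertified cert c d α s N z (z N) ∂(Measure.infinitePi fun _ : ℕ => D) ≤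
      ENNReal.ofReal (12 + 20 * √α) / (N + 1) := by
  set P := Measure.infinitePi fun _ : ℕ => D
  have hm : Measurable fun z : ℕ → X => uncertified cert c d α s N z (z N) :=
    measurable_uncertified hcert hc hdm measurable_const measurable_id (measurable_pi_apply N) α N
  have hswap : ∀ j, ∫⁻ z, uncertified cert c d α s N (z ∘ Equiv.swap j N) (z j) ∂P =
      ∫⁻ z, uncertified cert c d α s N z (z N) ∂P := fun j => by
    simpa using lintegral_infinitePi_perm D (Equiv.swap j N) hm
  rw [ENNReal.le_div_iff_mul_le (by simp) (by simp)]
  calc (∫⁻ z, uncertified cert c d α s N z (z N) ∂P) * (N + 1)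
      = ∑ j ∈ Finset.range (N + 1),
          ∫⁻ z, uncertified cert c d α s N (z ∘ Equiv.swap j N) (z j) ∂P := by
        simp [hswap, mul_comm]
    _ = ∫⁻ z, ∑ j ∈ Finset.range (N + 1),
          uncertified cert c d α s N (z ∘ Equiv.swap j N) (z j) ∂P := by
        refine (lintegral_finsetSum _ fun j _ => ?_).symm
        exact measurable_uncertified hcert hc hdm measurable_const
          (measurable_pi_iff.2 fun i => measurable_pi_apply _) (measurable_pi_apply j) α N
    _ ≤ ∫⁻ _z, ENNReal.ofReal (12 + 20 * √α) ∂P :=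
        lintegral_mono fun z => sum_uncertified_swap_le hd hs α N z
    _ = _ := by simp

lemma lintegral_expectedUncertified_succ (s : Label → X) (n i : ℕ) :
    ∫⁻ z, expectedUncertified cert c d α D (n + 1) s i z ∂(Measure.infinitePi fun _ : ℕ => D) =
      ∫⁻ z, uncertified cert c d α s i z (z i) ∂(Measure.infinitePi fun _ : ℕ => D) +
      ∫⁻ z, expectedUncertified cert c d α D n s (i + 1) z
        ∂(Measure.infinitePi fun _ : ℕ => D) := by
  have h1 : Measurable fun z : ℕ → X => uncertified cert c d α s i z (z i) :=
    measurable_uncertified hcert hc hdm measurable_const measurable_id (measurable_pi_apply i) α i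
  have h2 : Measurable fun z : ℕ → X => expectedUncertified cert c d α D n s (i + 1) z :=
    (measurable_expectedUncertified hcert hc hdm n (i + 1)).comp
      (measurable_const.prodMk measurable_id)
  rw [← lintegral_add_left h1, lintegral_infinitePi_update D i (h1.fun_add h2)]
  refine lintegral_congr fun z => lintegral_congr fun a => ?_
  simp only [Function.update_self]
  rw [uncertified_congr (l := Function.update z i a) (l' := z) fun j hj => Function.update_of_ne hj.ne _ _]

/-- Without given draws, the expected number of uncertified points is at most harmonic. -/
theorem expectedUncertified_zero_le (hd : MarginCertified cert d c) {s : Label → X}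
    (hs : ∀ y, c (s y) = y) (n : ℕ) (l : ℕ → X) :
    expectedUncertified cert c d α D n s 0 l ≤
      ∑ N ∈ Finset.range n, ENNReal.ofReal (12 + 20 * √α) / ((N : ENNReal) + 1) := by
  -- The recursion raises the starting index, so the induction covers every `i`, with the given
  -- draws averaged too. For `i = 0` this averaging has no effect.
  have h : ∀ i, ∫⁻ z, expectedUncertified cert c d α D n s i z
      ∂(Measure.infinitePi fun _ : ℕ => D) ≤
      ∑ N ∈ Finset.range n, ENNReal.ofReal (12 + 20 * √α) / (((N + i : ℕ) : ENNReal) + 1) := by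
    induction n with
    | zero => intro i; simp [expectedUncertified]
    | succ n ih =>
      intro i
      rw [lintegral_expectedUncertified_succ hcert hc hdm, Finset.sum_range_succ', add_comm]
      refine add_le_add ((ih (i + 1)).trans_eq (Finset.sum_congr rfl fun N _ => ?_)) ?_
      · congr 3; ring
      · simpa using lintegral_uncertified_le hcert hc hdm hd hs i
  calc expectedUncertified cert c d α D n s 0 l
      = ∫⁻ _z, expectedUncertified cert c d α D n s 0 l ∂(Measure.infinitePi fun _ : ℕ => D) := by
        simp
    _ = ∫⁻ z, expectedUncertified cert c d α D n s 0 z ∂(Measure.infinitePi fun _ : ℕ => D) :=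
        lintegral_congr fun z => expectedUncertified_congr (by simp)
    _ ≤ _ := by simpa using h 0

end Potential

/-! ### Anchors and fresh draws along a sequence of rounds -/

section State

variable {X : Type*} (c : Concept X) (x : ℕ → X) (q : ℕ → Bool)

/-- Both labels occur among the first `t` instances. -/
def BothSeen (t : ℕ) : Prop := ∀ y, ∃ u < t, c (x u) = y

variable {c x q}

lemma BothSeen.mono {s t : ℕ} (hst : s ≤ t) (h : BothSeen c x s) : BothSeen c x t := fun y =>
  (h y).imp fun _ hu => ⟨hu.1.trans_le hst, hu.2⟩

lemma bothSeen_congr {x' : ℕ → X} {t : ℕ} (h : ∀ u < t, x u = x' u) :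
    BothSeen c x t ↔ BothSeen c x' t :=
  forall_congr' fun y => exists_congr fun u => and_congr_right fun hu => by rw [h u hu]

open Classical in
/-- The indicator of an abstention in an i.i.d. round. -/
noncomputable def abstention (cert : X → X → X → X → Prop) (c : Concept X) (α : ℕ) (x : ℕ → X)
    (q : ℕ → Bool) (t : ℕ) : ENNReal :=
  if votePredict cert α t (examples c x t) (x t) = Prediction.abstain ∧ q t = false then 1 else 0

variable {cert : X → X → X → X → Prop} {d : X → ℝ} {α : ℕ}

lemma abstention_eq_zero (hd : MarginCertified cert d c) {t : ℕ}
    (h : ¬ (BothSeen c x t ∧ q t = false)) : abstention cert c α x q t = 0 :=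
  if_neg fun h' => h ⟨(card_lt_of_abstain hd h'.1).1, h'.2⟩

lemma abstention_congr {x' : ℕ → X} {q' : ℕ → Bool} {t : ℕ} (h : ∀ u ≤ t, x u = x' u)
    (hq : q t = q' t) : abstention cert c α x q t = abstention cert c α x' q' t := by
  have : examples c x t = examples c x' t := funext fun s => by
    simp only [examples, h s s.2.le]
  classical exact if_congr (by rw [this, h t le_rfl, hq]) rfl rfl

variable (c x q)

open Classical in
/-- The number of i.i.d. rounds before round `t` that follow the occurrence of both labels. -/
noncomputable def drawCount : ℕ → ℕ
  | 0 => 0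
  | t + 1 => if BothSeen c x t ∧ q t = false then drawCount t + 1 else drawCount t

variable {c x q}

lemma drawCount_congr {x' : ℕ → X} {q' : ℕ → Bool} {t : ℕ} (h : ∀ u < t, x u = x' u)
    (hq : ∀ u < t, q u = q' u) : drawCount c x q t = drawCount c x' q' t := by
  induction t with
  | zero => rfl
  | succ t ih =>
    have hd := ih (fun u hu => h u (by omega)) fun u hu => hq u (by omega)
    classical
    refine if_congr (and_congr (bothSeen_congr fun u hu => h u (by omega)) ?_) ?_ hd
    · rw [hq t (by omega)]
    · rw [hd]

/-- The index is `t + 1`: a round that reveals the second label supplies an anchor and is not itself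
counted. -/
lemma drawCount_eq_zero {t : ℕ} (h : ¬ BothSeen c x t) : drawCount c x q (t + 1) = 0 := by
  induction t with
  | zero => simp [drawCount, h]
  | succ t ih =>
    rw [drawCount, if_neg fun h' => h h'.1, ih fun h' => h (h'.mono t.le_succ)]

variable (c x q) [Inhabited X]

open Classical in
/-- The first among the first `t` instances with a given label. -/
noncomputable def anchor : ℕ → Label → X
  | 0, _ => default
  | t + 1, y => if ∃ u < t, c (x u) = y then anchor t y else x t

open Classical in
/-- The instances of the rounds counted by `drawCount`. -/
noncomputable def draws : ℕ → ℕ → X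
  | 0 => default
  | t + 1 => if BothSeen c x t ∧ q t = false then
      Function.update (draws t) (drawCount c x q t) (x t) else draws t

variable {c x q}

lemma anchor_congr {x' : ℕ → X} {t : ℕ} (h : ∀ u < t, x u = x' u) :
    anchor c x t = anchor c x' t := by
  induction t with
  | zero => rfl
  | succ t ih =>
    funext y
    have : (∃ u < t, c (x u) = y) ↔ ∃ u < t, c (x' u) = y :=
      exists_congr fun u => and_congr_right fun hu => by rw [h u (by omega)]
    simp only [anchor, this, ih fun u hu => h u (by omega), h t (by omega)]

lemma draws_congr {x' : ℕ → X} {q' : ℕ → Bool} {t : ℕ} (h : ∀ u < t, x u = x' u)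
    (hq : ∀ u < t, q u = q' u) : draws c x q t = draws c x' q' t := by
  induction t with
  | zero => rfl
  | succ t ih =>
    have hl := ih (fun u hu => h u (by omega)) fun u hu => hq u (by omega)
    classical
    refine if_congr (and_congr (bothSeen_congr fun u hu => h u (by omega)) ?_) ?_ hl
    · rw [hq t (by omega)]
    · rw [hl, h t (by omega), drawCount_congr (fun u hu => h u (by omega))
        fun u hu => hq u (by omega)]

lemma anchor_spec {t : ℕ} {y : Label} (h : ∃ u < t, c (x u) = y) :
    ∃ k < t, anchor c x t y = x k ∧ c (x k) = y ∧ ∀ u < k, c (x u) ≠ y := by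
  induction t with
  | zero => obtain ⟨u, hu, -⟩ := h; omega
  | succ t ih =>
    by_cases ht : ∃ u < t, c (x u) = y
    · obtain ⟨k, hk, h1, h2⟩ := ih ht
      exact ⟨k, by omega, by simp only [anchor, if_pos ht, h1], h2⟩
    · obtain ⟨u, hu, huy⟩ := h
      have hut : u = t := by
        by_contra hne
        exact ht ⟨u, by omega, huy⟩
      subst hut
      push Not at ht
      exact ⟨u, by omega, by simp only [anchor]; rw [if_neg (by push Not; exact ht)], huy, ht⟩

lemma anchor_label {t : ℕ} (h : BothSeen c x t) (y : Label) : c (anchor c x t y) = y := by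
  obtain ⟨k, -, h1, h2, -⟩ := anchor_spec (h y)
  rw [h1, h2]

lemma anchor_succ {t : ℕ} (h : BothSeen c x t) : anchor c x (t + 1) = anchor c x t :=
  funext fun y => if_pos (h y)

/-- The counted draws come from distinct earlier rounds, so pairs of draws inject into pairs of
examples available to the learner. -/
lemma exists_draws_eq (t : ℕ) : ∃ f : ℕ → ℕ, Set.InjOn f (Set.Iio (drawCount c x q t)) ∧
    ∀ a < drawCount c x q t, f a < t ∧ draws c x q t a = x (f a) := by
  induction t with
  | zero => exact ⟨id, fun _ _ _ _ h => h, by simp [drawCount]⟩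
  | succ t ih =>
    obtain ⟨f, hinj, hf⟩ := ih
    by_cases h : BothSeen c x t ∧ q t = false
    · simp only [drawCount, draws, if_pos h]
      set m := drawCount c x q t
      have hlt : ∀ a < m + 1, a ≠ m → a < m := fun a ha hne => by omega
      refine ⟨Function.update f m t, fun a ha b hb hab => ?_, fun a ha => ?_⟩
      · by_cases ham : a = m <;> by_cases hbm : b = m
        · rw [ham, hbm]
        · subst ham
          rw [Function.update_self, Function.update_of_ne hbm] at hab
          have := (hf b (hlt b hb hbm)).1
          omega
        · subst hbm
          rw [Function.update_self, Function.update_of_ne ham] at hab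
          have := (hf a (hlt a ha ham)).1
          omega
        · rw [Function.update_of_ne ham, Function.update_of_ne hbm] at hab
          exact hinj (hlt a ha ham) (hlt b hb hbm) hab
      · by_cases ham : a = m
        · subst ham; simp
        · rw [Function.update_of_ne ham, Function.update_of_ne ham]
          exact ⟨(hf a (hlt a ha ham)).1.trans t.lt_succ_self, (hf a (hlt a ha ham)).2⟩
    · simp only [drawCount, draws, if_neg h]
      exact ⟨f, hinj, fun a ha => ⟨(hf a ha).1.trans t.lt_succ_self, (hf a ha).2⟩⟩

lemma abstention_le_uncertified (hd : MarginCertified cert d c) (t : ℕ) :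
    abstention cert c α x q t ≤
      uncertified cert c d α (anchor c x t) (drawCount c x q t) (draws c x q t) (x t) := by
  classical
  unfold abstention
  split_ifs with h
  swap
  · exact zero_le
  obtain ⟨hboth, hlt⟩ := card_lt_of_abstain hd h.1
  obtain ⟨k, hk, h1, h2, h3⟩ := anchor_spec (hboth (!c (x t)))
  have hcount := hlt (anchor c x t (!c (x t))) ⟨k, hk, h1, by rw [h2]; cases c (x t) <;> decide,
    fun u hu => by simpa using h3 u hu⟩
  obtain ⟨f, hinj, hf⟩ := exists_draws_eq (c := c) (x := x) (q := q) t
  unfold uncertified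
  rw [if_pos]
  refine lt_of_le_of_lt (Finset.card_le_card_of_injOn (fun p => (f p.1, f p.2)) ?_ ?_) hcount
  · rintro ⟨a, b⟩ hp
    obtain ⟨hab, hp⟩ := Finset.mem_filter.1 hp
    obtain ⟨ha, hb⟩ := Finset.mem_product.1 hab
    obtain ⟨ha1, ha2⟩ := hf a (Finset.mem_range.1 ha)
    obtain ⟨hb1, hb2⟩ := hf b (Finset.mem_range.1 hb)
    simp only [ha2, hb2] at hp
    exact Finset.mem_filter.2 ⟨by simp [ha1, hb1], hp⟩
  · rintro ⟨a, b⟩ hp ⟨a', b'⟩ hp' h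
    obtain ⟨ha, hb⟩ := Finset.mem_product.1 (Finset.mem_filter.1 hp).1
    obtain ⟨ha', hb'⟩ := Finset.mem_product.1 (Finset.mem_filter.1 hp').1
    simp only [Prod.mk.injEq] at h
    exact Prod.ext (hinj (Finset.mem_range.1 ha) (Finset.mem_range.1 ha') h.1)
      (hinj (Finset.mem_range.1 hb) (Finset.mem_range.1 hb') h.2)

end State

/-! ### The expected number of abstentions -/

section Abstentions

variable {X : Type*} [MeasurableSpace X] {cert : X → X → X → X → Prop}
  {c : Concept X} {d : X → ℝ} {α : ℕ} {D : Measure X}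

open Classical in
/-- A bound on the expected number of abstentions in the `n` rounds from round `t` on, given the
earlier rounds; `B` is the bound in case one of the labels is still to be seen. -/
noncomputable def futureAbstentions [Inhabited X] (cert : X → X → X → X → Prop) (c : Concept X) (d : X → ℝ)
    (α : ℕ) (D : Measure X) (B : ENNReal) (n : ℕ) (x : ℕ → X) (q : ℕ → Bool) (t : ℕ) : ENNReal :=
  if BothSeen c x t then
    expectedUncertified cert c d α D n (anchor c x t) (drawCount c x q t) (draws c x q t)
  else B

section Measurability

variable {Y : Type*} [MeasurableSpace Y] {x : Y → ℕ → X} {q : Y → ℕ → Bool}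
  (hc : Measurable c) (hx : Measurable x) (hq : Measurable q)
  (hcert : MeasurableSet {p : X × X × X × X | cert p.1 p.2.1 p.2.2.1 p.2.2.2})

include hc hx

lemma measurable_label_eq (u : ℕ) (y : Label) : Measurable fun ω => c (x ω u) = y :=
  measurableSet_setOfPred.1 (measurableSet_eq_fun (hc.comp hx.eval) measurable_const)

lemma measurable_exists_label_eq (t : ℕ) (y : Label) :
    Measurable fun ω => ∃ u < t, c (x ω u) = y :=
  Measurable.exists fun u => measurable_const.and (measurable_label_eq hc hx u y)

lemma measurable_bothSeen (t : ℕ) : Measurable fun ω => BothSeen c (x ω) t :=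
  Measurable.forall fun y => measurable_exists_label_eq hc hx t y

include hq hcert in
lemma measurable_abstention (t : ℕ) :
    Measurable fun ω => abstention cert c α (x ω) (q ω) t := by
  have h : Measurable fun ω => votePredict cert α t (examples c (x ω) t) (x ω t) :=
    ((voteLearner hcert α).measurable_predict t).comp ((measurable_pi_iff.2 fun s =>
      hx.eval.prodMk (hc.comp hx.eval)).prodMk hx.eval)
  exact Measurable.ite ((h (MeasurableSpace.measurableSet_top (s := {Prediction.abstain}))).inter
    (measurableSet_eq_fun hq.eval measurable_const)) measurable_const measurable_const

include hq in
lemma measurableSet_bothSeen_and (t : ℕ) :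
    MeasurableSet {ω | BothSeen c (x ω) t ∧ q ω t = false} :=
  measurableSet_setOfPred.2 ((measurable_bothSeen hc hx t).and
    (measurableSet_setOfPred.1 (measurableSet_eq_fun hq.eval measurable_const)))

include hq in
lemma measurable_drawCount (t : ℕ) : Measurable fun ω => drawCount c (x ω) (q ω) t := by
  induction t with
  | zero => exact measurable_const
  | succ t ih =>
    exact Measurable.ite (measurableSet_bothSeen_and hc hx hq t) (ih.add_const 1) ih

variable [Inhabited X]

lemma measurable_anchor (t : ℕ) : Measurable fun ω => anchor c (x ω) t := by
  induction t with
  | zero => exact measurable_const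
  | succ t ih =>
    refine measurable_pi_iff.2 fun y => Measurable.ite (measurableSet_setOfPred.2
      (measurable_exists_label_eq hc hx t y)) ih.eval hx.eval

include hq

lemma measurable_draws (t : ℕ) : Measurable fun ω => draws c (x ω) (q ω) t := by
  induction t with
  | zero => exact measurable_const
  | succ t ih =>
    refine Measurable.ite (measurableSet_bothSeen_and hc hx hq t) ?_ ih
    refine measurable_pi_iff.2 fun j => ?_
    simp only [Function.update_apply]
    exact Measurable.ite (measurableSet_eq_fun measurable_const
      (measurable_drawCount hc hx hq t)) hx.eval ih.eval

include hcert

lemma measurable_futureAbstentions (hdm : Measurable d) [SFinite D] (B : ENNReal) (n t : ℕ) :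
    Measurable fun ω => futureAbstentions cert c d α D B n (x ω) (q ω) t := by
  refine Measurable.ite (measurableSet_setOfPred.2 (measurable_bothSeen hc hx t)) ?_
    measurable_const
  have h : Measurable fun p : ℕ × ((Label → X) × (ℕ → X)) =>
      expectedUncertified cert c d α D n p.2.1 p.1 p.2.2 :=
    measurable_from_prod_countable_right fun i => measurable_expectedUncertified hcert hc hdm n i
  exact h.comp ((measurable_drawCount hc hx hq t).prodMk
    ((measurable_anchor hc hx t).prodMk (measurable_draws hc hx hq t)))

end Measurability

variable [Inhabited X] {B : ENNReal} {x : ℕ → X} {q : ℕ → Bool} {n t : ℕ}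

lemma futureAbstentions_congr {x' : ℕ → X} {q' : ℕ → Bool} (h : ∀ u < t, x u = x' u)
    (hq : ∀ u < t, q u = q' u) : futureAbstentions cert c d α D B n x q t =
      futureAbstentions cert c d α D B n x' q' t := by
  classical
  refine if_congr (bothSeen_congr h) ?_ rfl
  rw [anchor_congr h, drawCount_congr h hq, draws_congr h hq]

/-- In an uncounted round no abstention is charged. Once both labels are known the state is
unchanged; before that the potential is `B`, which dominates the potential with no draws for any
anchors the adversary may produce. -/
lemma futureAbstentions_succ_le (hd : MarginCertified cert d c)
    (hB : ∀ s : Label → X, (∀ y, c (s y) = y) → ∀ l, expectedUncertified cert c d α D n s 0 l ≤ B)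
    (h : ¬ (BothSeen c x t ∧ q t = false)) :
    abstention cert c α x q t + futureAbstentions cert c d α D B n x q (t + 1) ≤
      futureAbstentions cert c d α D B (n + 1) x q t := by
  rw [abstention_eq_zero hd h, zero_add]
  unfold futureAbstentions
  by_cases hb : BothSeen c x t
  · rw [if_pos hb, if_pos (hb.mono t.le_succ), anchor_succ hb, drawCount, draws, if_neg h, if_neg h]
    exact expectedUncertified_le_succ _ _ _ _
  · rw [if_neg hb]
    split_ifs with hb'
    · rw [drawCount_eq_zero hb]
      exact hB _ (anchor_label hb') _
    · exact le_rfl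

lemma futureAbstentions_succ_le_of_draw (hd : MarginCertified cert d c)
    (h : BothSeen c x t ∧ q t = false) :
    abstention cert c α x q t + futureAbstentions cert c d α D B n x q (t + 1) ≤
      uncertified cert c d α (anchor c x t) (drawCount c x q t) (draws c x q t) (x t) +
        expectedUncertified cert c d α D n (anchor c x t) (drawCount c x q t + 1)
          (Function.update (draws c x q t) (drawCount c x q t) (x t)) := by
  refine add_le_add (abstention_le_uncertified hd t) (le_of_eq ?_)
  rw [futureAbstentions, if_pos (h.1.mono t.le_succ), anchor_succ h.1, drawCount, draws,
    if_pos h, if_pos h]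

variable {Ω : Type*} [MeasurableSpace Ω] (L : Learner X) (A : Adversary Ω X)
  (hcert : MeasurableSet {p : X × X × X × X | cert p.1 p.2.1 p.2.2.1 p.2.2.2})
  (hc : Measurable c) (hdm : Measurable d)

lemma lintegral_futureAbstentions_succ_le [IsProbabilityMeasure D] (hd : MarginCertified cert d c)
    (hB : ∀ s : Label → X, (∀ y, c (s y) = y) → ∀ l, expectedUncertified cert c d α D n s 0 l ≤ B)
    (ω : Ω) (z : ℕ → X) :
    ∫⁻ a, (abstention cert c α (fun u => (play L c A ω (Function.update z t a) u).1)
        (fun u => (play L c A ω (Function.update z t a) u).2.1) t +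
      futureAbstentions cert c d α D B n (fun u => (play L c A ω (Function.update z t a) u).1)
        (fun u => (play L c A ω (Function.update z t a) u).2.1) (t + 1)) ∂D ≤
      futureAbstentions cert c d α D B (n + 1) (fun u => (play L c A ω z u).1)
        (fun u => (play L c A ω z u).2.1) t := by
  have hplay : ∀ a, ∀ u < t, play L c A ω (Function.update z t a) u = play L c A ω z u :=
    fun a u hu => play_congr fun s hs => Function.update_of_ne (by omega) _ _
  have hrec : ∀ a, record L c A ω (Function.update z t a) t = record L c A ω z t :=
    fun a => record_congr fun s hs => Function.update_of_ne hs.ne _ _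
  have hx : ∀ a, ∀ u < t, (fun u => (play L c A ω (Function.update z t a) u).1) u =
      (fun u => (play L c A ω z u).1) u := fun a u hu => by simp only [hplay a u hu]
  have hq : ∀ a, ∀ u < t, (fun u => (play L c A ω (Function.update z t a) u).2.1) u =
      (fun u => (play L c A ω z u).2.1) u := fun a u hu => by simp only [hplay a u hu]
  -- The hidden bit is fixed by the seed and the record before nature draws; hence whether the round
  -- is counted does not depend on `a`.
  have hqt : ∀ a, (play L c A ω (Function.update z t a) t).2.1 = (play L c A ω z t).2.1 :=
    fun a => by simp only [play_bit, hrec a]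
  by_cases h : BothSeen c (fun u => (play L c A ω z u).1) t ∧ (play L c A ω z t).2.1 = false
  · have hxt : ∀ a, (play L c A ω (Function.update z t a) t).1 = a := fun a => by
      have := hqt a
      rw [h.2, play_bit] at this
      rw [play_instance, this]
      simp
    rw [futureAbstentions, if_pos h.1, expectedUncertified]
    refine lintegral_mono fun a => ?_
    refine (futureAbstentions_succ_le_of_draw hd
      ⟨(bothSeen_congr (hx a)).2 h.1, (hqt a).trans h.2⟩).trans_eq ?_
    rw [anchor_congr (hx a), drawCount_congr (hx a) (hq a), draws_congr (hx a) (hq a), hxt a]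
  · calc
      _ ≤ ∫⁻ _a, futureAbstentions cert c d α D B (n + 1) (fun u => (play L c A ω z u).1)
            (fun u => (play L c A ω z u).2.1) t ∂D := by
          refine lintegral_mono fun a => ?_
          refine (futureAbstentions_succ_le hd hB fun h' =>
            h ⟨(bothSeen_congr (hx a)).1 h'.1, (hqt a).symm.trans h'.2⟩).trans_eq ?_
          exact futureAbstentions_congr (hx a) (hq a)
      _ = _ := by simp

include hcert hc hdm in
theorem lintegral_sum_abstention_le [IsProbabilityMeasure D] (hd : MarginCertified cert d c)
    (ω : Ω) (T : ℕ) :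
    ∫⁻ z, ∑ u ∈ Finset.range T, abstention cert c α (fun u => (play L c A ω z u).1)
        (fun u => (play L c A ω z u).2.1) u ∂(Measure.infinitePi fun _ : ℕ => D) ≤
      ∑ N ∈ Finset.range T, ENNReal.ofReal (12 + 20 * √α) / ((N : ENNReal) + 1) := by
  set P := Measure.infinitePi fun _ : ℕ => D
  set B := ∑ N ∈ Finset.range T, ENNReal.ofReal (12 + 20 * √α) / ((N : ENNReal) + 1)
  have hpm : ∀ u, Measurable fun z : ℕ → X => play L c A ω z u := fun u =>
    (measurable_play hc u).comp measurable_prodMk_left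
  have hxm : Measurable fun (z : ℕ → X) u => (play L c A ω z u).1 :=
    measurable_pi_iff.2 fun u => (hpm u).fst
  have hqm : Measurable fun (z : ℕ → X) u => (play L c A ω z u).2.1 :=
    measurable_pi_iff.2 fun u => (hpm u).snd.fst
  have hB : ∀ n ≤ T, ∀ s : Label → X, (∀ y, c (s y) = y) → ∀ l,
      expectedUncertified cert c d α D n s 0 l ≤ B := fun n hn s hs l =>
    (expectedUncertified_zero_le hcert hc hdm hd hs n l).trans
      (Finset.sum_le_sum_of_subset (Finset.range_subset_range.2 hn))
  -- Supermartingale invariant: past abstentions plus the potential have expectation at most `B`. At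
  -- `t = 0` no label has been seen, so the potential equals `B`.
  have key : ∀ t n, n + t ≤ T → ∫⁻ z, (∑ u ∈ Finset.range t, abstention cert c α
        (fun u => (play L c A ω z u).1) (fun u => (play L c A ω z u).2.1) u +
      futureAbstentions cert c d α D B n (fun u => (play L c A ω z u).1)
        (fun u => (play L c A ω z u).2.1) t) ∂P ≤ B := by
    intro t
    induction t with
    | zero =>
      intro n _
      have : ∀ x : ℕ → X, ¬ BothSeen c x 0 := fun x h => by
        obtain ⟨u, hu, -⟩ := h true
        omega
      simp [futureAbstentions, this]
    | succ t ih =>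
      intro n hn
      refine le_trans ?_ (ih (n + 1) (by omega))
      -- With draw number `t` resampled, everything before round `t` is constant in the inner
      -- integral.
      rw [lintegral_infinitePi_update D t]
      swap
      · exact (Finset.measurable_fun_sum _ fun u _ => measurable_abstention hc hxm hqm hcert u).fun_add
          (measurable_futureAbstentions hc hxm hqm hcert hdm B n (t + 1))
      refine lintegral_mono fun z => ?_
      have hsum : ∀ a, ∑ u ∈ Finset.range t, abstention cert c α
          (fun u => (play L c A ω (Function.update z t a) u).1)
          (fun u => (play L c A ω (Function.update z t a) u).2.1) u =
          ∑ u ∈ Finset.range t, abstention cert c α (fun u => (play L c A ω z u).1)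
          (fun u => (play L c A ω z u).2.1) u := fun a => Finset.sum_congr rfl fun u hu => by
        have hplay : ∀ v ≤ u, play L c A ω (Function.update z t a) v = play L c A ω z v :=
          fun v hv => play_congr fun s hs => Function.update_of_ne
            (by have := Finset.mem_range.1 hu; omega) _ _
        exact abstention_congr (fun v hv => by simp only [hplay v hv]) (by simp only [hplay u le_rfl])
      simp only [Finset.sum_range_succ, hsum, add_assoc]
      rw [lintegral_add_left measurable_const, lintegral_const, measure_univ, mul_one]
      exact add_le_add le_rfl (lintegral_futureAbstentions_succ_le L A hd (hB n (by omega)) ω z)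
  exact (lintegral_mono fun z => le_self_add).trans (key T 0 (by omega))

end Abstentions

/-! ### The combined error -/

section CombinedError

variable {X : Type*} [MeasurableSpace X] {cert : X → X → X → X → Prop}
  {c : Concept X} {d : X → ℝ} {α : ℕ} {D : Measure X} [IsProbabilityMeasure D]
  {Ω : Type*} [MeasurableSpace Ω] {μ : Measure Ω} [IsProbabilityMeasure μ]

lemma measurable_combinedError (hc : Measurable c) (L : Learner X) (A : Adversary Ω X) (T : ℕ) :
    Measurable (combinedError L c A T) := by
  classical
  have hr : ∀ t, Measurable fun p : Ω × (ℕ → X) => record L c A p.1 p.2 T t := fun t =>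
    (measurable_record hc T).eval
  have hyy : MeasurableSet {p : Prediction × Label | p.1 = Prediction.label p.2} := by
    have h : {p : Prediction × Label | p.1 = Prediction.label p.2} =
        ⋃ y, {Prediction.label y} ×ˢ {y} := by
      ext ⟨u, y⟩
      cases y <;> simp
    rw [h]
    exact MeasurableSet.iUnion fun y => MeasurableSpace.measurableSet_top.prod
      (measurableSet_singleton y)
  unfold combinedError errMis errAbs
  refine Measurable.add ?_ ?_
  · refine Finset.measurable_fun_sum _ fun t _ => Measurable.ite ?_ measurable_const measurable_const
    exact ((hyy.preimage ((hr t).snd.snd.fst.prodMk (hr t).snd.snd.snd)).compl).inter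
      ((hr t).snd.snd.fst (MeasurableSpace.measurableSet_top (s := {Prediction.abstain}))).compl
  · refine Finset.measurable_fun_sum _ fun t _ => Measurable.ite ?_ measurable_const measurable_const
    exact ((hr t).snd.snd.fst (MeasurableSpace.measurableSet_top (s := {Prediction.abstain}))).inter
      (measurableSet_eq_fun (hr t).snd.fst measurable_const)

lemma combinedError_nonneg (L : Learner X) (A : Adversary Ω X) (T : ℕ) (p : Ω × (ℕ → X)) :
    0 ≤ combinedError L c A T p := by
  rw [combinedError, errMis_record, errAbs_record]
  positivity

lemma sum_range_div_le_log {C : ℝ} (hC : 0 ≤ C) (T : ℕ) :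
    ∑ N ∈ Finset.range T, ENNReal.ofReal C / ((N : ENNReal) + 1) ≤
      ENNReal.ofReal (C * (1 + Real.log T)) := by
  have h : ∀ N : ℕ, ENNReal.ofReal C / ((N : ENNReal) + 1) =
      ENNReal.ofReal (C * ((N + 1 : ℕ) : ℝ)⁻¹) := fun N => by
    rw [← div_eq_mul_inv, ENNReal.ofReal_div_of_pos (by positivity), ENNReal.ofReal_natCast]
    simp
  simp only [h]
  rw [← ENNReal.ofReal_sum_of_nonneg fun N _ => by positivity, ← Finset.mul_sum]
  refine ENNReal.ofReal_le_ofReal (mul_le_mul_of_nonneg_left ?_ hC)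
  have := harmonic_le_one_add_log T
  simpa [harmonic] using this

/-- The expected combined error of the learner with threshold `α`. -/
theorem integral_combinedError_le [Inhabited X] (hα : 0 < α)
    (hcert : MeasurableSet {p : X × X × X × X | cert p.1 p.2.1 p.2.2.1 p.2.2.2})
    (hc : Measurable c) (hdm : Measurable d) (hd : MarginCertified cert d c)
    (A : Adversary Ω X) {T : ℕ} (hT : 1 ≤ T) :
    Integrable (combinedError (voteLearner hcert α) c A T) (protocolLaw μ D) ∧
      ∫ p, combinedError (voteLearner hcert α) c A T p ∂(protocolLaw μ D) ≤
        2 + (T : ℝ) ^ 2 / α + (12 + 20 * √α) * (1 + Real.log T) := by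
  set L := voteLearner hcert α
  have hlog : 0 ≤ Real.log T := Real.log_nonneg (by exact_mod_cast hT)
  have hm := measurable_combinedError hc L A T
  have hpt : ∀ p : Ω × (ℕ → X), ENNReal.ofReal (combinedError L c A T p) ≤
      ENNReal.ofReal (2 + (T : ℝ) ^ 2 / α) + ∑ u ∈ Finset.range T,
        abstention cert c α (fun u => (play L c A p.1 p.2 u).1)
          (fun u => (play L c A p.1 p.2 u).2.1) u := fun p => by
    classical
    rw [combinedError, ENNReal.ofReal_add (by rw [errMis_record]; positivity)
      (by rw [errAbs_record]; positivity), errMis_record, errAbs_record]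
    simp only [play_prediction]
    refine add_le_add (ENNReal.ofReal_le_ofReal
      (card_mistakes_le (cert := cert) (c := c) (x := fun u => (play L c A p.1 p.2 u).1) hα T)) ?_
    unfold abstention
    rw [Finset.sum_boole, ENNReal.ofReal_natCast]
    exact le_rfl
  have hbound : ∫⁻ p, ENNReal.ofReal (combinedError L c A T p) ∂(protocolLaw μ D) ≤
      ENNReal.ofReal (2 + (T : ℝ) ^ 2 / α + (12 + 20 * √α) * (1 + Real.log T)) := by
    -- By Tonelli the seed may be fixed, leaving a deterministic adaptive adversary.
    rw [protocolLaw, lintegral_prod _ hm.ennreal_ofReal.aemeasurable]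
    calc _ ≤ ∫⁻ _ω, ENNReal.ofReal (2 + (T : ℝ) ^ 2 / α + (12 + 20 * √α) * (1 + Real.log T)) ∂μ := by
          refine lintegral_mono fun ω => (lintegral_mono fun z => hpt (ω, z)).trans ?_
          rw [lintegral_add_left measurable_const]
          refine le_trans ?_ (ENNReal.ofReal_add (by positivity) (by positivity)).ge
          refine add_le_add (by simp) ?_
          exact (lintegral_sum_abstention_le L A hcert hc hdm hd ω T).trans
            (sum_range_div_le_log (by positivity) T)
      _ = _ := by simp
  have hnn : 0 ≤ᵐ[protocolLaw μ D] combinedError L c A T :=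
    Filter.Eventually.of_forall fun p => combinedError_nonneg L A T p
  refine ⟨⟨hm.aestronglyMeasurable, ?_⟩, ?_⟩
  · rw [hasFiniteIntegral_iff_ofReal hnn]
    exact hbound.trans_lt ENNReal.ofReal_lt_top
  · rw [integral_eq_lintegral_of_nonneg_ae hnn hm.aestronglyMeasurable]
    exact ENNReal.toReal_le_of_le_ofReal (by positivity) hbound

end CombinedError

/-! ### Halfspaces -/

/-- The set is the projection of a closed set along the coefficients `(α, β)`. Projections need not
be Borel in general, but a closed set in a σ-compact space is σ-compact, and so is its continuous
image. -/
lemma measurableSet_extends :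
    MeasurableSet {p : Plane × Plane × Plane × Plane | Extends p.1 p.2.1 p.2.2.1 p.2.2.2} := by
  have hcl : IsClosed {p : (ℝ × ℝ) × Plane × Plane × Plane × Plane |
      p.2.2.2.2 - p.2.1 = p.1.1 • (p.2.2.1 - p.2.1) + p.1.2 • (p.2.2.2.1 - p.2.1) ∧
        0 ≤ p.1.2 ∧ 1 ≤ p.1.1 + p.1.2} := by
    have h1 : IsClosed {p : (ℝ × ℝ) × Plane × Plane × Plane × Plane |
        p.2.2.2.2 - p.2.1 = p.1.1 • (p.2.2.1 - p.2.1) + p.1.2 • (p.2.2.2.1 - p.2.1)} :=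
      isClosed_eq (by fun_prop) (by fun_prop)
    have h2 : IsClosed {p : (ℝ × ℝ) × Plane × Plane × Plane × Plane | 0 ≤ p.1.2} :=
      isClosed_le (by fun_prop) (by fun_prop)
    have h3 : IsClosed {p : (ℝ × ℝ) × Plane × Plane × Plane × Plane | 1 ≤ p.1.1 + p.1.2} :=
      isClosed_le (by fun_prop) (by fun_prop)
    exact h1.inter (h2.inter h3)
  have hσ := (isSigmaCompact_univ.of_isClosed_subset hcl (Set.subset_univ _)).image continuous_snd
  obtain ⟨K, hK, hKU⟩ := hσ
  have himg : {p : Plane × Plane × Plane × Plane | Extends p.1 p.2.1 p.2.2.1 p.2.2.2} =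
      ⋃ n, K n := by
    rw [hKU]
    ext p
    simp [Extends]
  rw [himg]
  exact MeasurableSet.iUnion fun n => (hK n).measurableSet

lemma measurable_halfspace (w : Plane) (b : ℝ) :
    Measurable fun x : Plane => sign (inner ℝ w x + b) := by
  have h : MeasurableSet {x : Plane | 0 ≤ (inner ℝ w x : ℝ) + b} :=
    measurableSet_le measurable_const (by fun_prop)
  exact measurable_to_bool (by simpa [Set.preimage, sign] using h)

/-- With `y = T ^ (2/3)` and `α = ⌈y ^ 2⌉`, one has `T ^ 2 / α ≤ y` and `√α ≤ 2 y`; since `y ≥ 1`,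
the constants add up to `2 + 1 + (12 + 40) = 55`. -/
lemma error_bound_le {T : ℕ} (hT : 1 ≤ T) :
    2 + (T : ℝ) ^ 2 / (⌈(T : ℝ) ^ (4 / 3 : ℝ)⌉₊ : ℝ) +
      (12 + 20 * √(⌈(T : ℝ) ^ (4 / 3 : ℝ)⌉₊ : ℝ)) * (1 + Real.log T) ≤
      55 * (T : ℝ) ^ (2 / 3 : ℝ) * (1 + Real.log T) ^ 1 := by
  have hT' : (1 : ℝ) ≤ T := by exact_mod_cast hT
  have hT0 : (0 : ℝ) < T := by linarith
  have hlog : 0 ≤ Real.log T := Real.log_nonneg hT'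
  set y : ℝ := (T : ℝ) ^ (2 / 3 : ℝ) with hy
  have hy1 : 1 ≤ y := Real.one_le_rpow hT' (by norm_num)
  have hyy : (T : ℝ) ^ (4 / 3 : ℝ) = y ^ 2 := by
    rw [hy, ← Real.rpow_natCast, ← Real.rpow_mul hT0.le]; norm_num
  have hyyy : (T : ℝ) ^ 2 = y ^ 3 := by
    rw [hy, ← Real.rpow_natCast (_ ^ _), ← Real.rpow_mul hT0.le]; norm_num
  rw [hyy, hyyy]
  have h1 : y ^ 2 ≤ (⌈y ^ 2⌉₊ : ℝ) := Nat.le_ceil _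
  have h2 : (⌈y ^ 2⌉₊ : ℝ) < y ^ 2 + 1 := Nat.ceil_lt_add_one (by positivity)
  have h3 : y ^ 3 / (⌈y ^ 2⌉₊ : ℝ) ≤ y := by
    rw [div_le_iff₀ (by nlinarith)]
    nlinarith
  have h4 : √(⌈y ^ 2⌉₊ : ℝ) ≤ 2 * y := by
    rw [Real.sqrt_le_left (by linarith)]
    nlinarith
  have h5 : (12 + 20 * √(⌈y ^ 2⌉₊ : ℝ)) * (1 + Real.log T) ≤ (52 * y) * (1 + Real.log T) :=
    mul_le_mul_of_nonneg_right (by linarith) (by linarith)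
  nlinarith [mul_nonneg (by linarith : 0 ≤ y) hlog]

end AdversarialInjection

open AdversarialInjection in
theorem theorem5p4 :
    (∀ sPos sNeg : Plane, sPos ≠ sNeg →
      HasCertificateDimension (anchoredHalfspaces sPos sNeg) 3 7 3) ∧
    ∃ (K : ℝ) (r : ℕ), ∀ T : ℕ, 1 ≤ T →
      ∃ L : Learner Plane,
        ∀ (D : Measure Plane) [IsProbabilityMeasure D], ∀ c ∈ halfspaces,
          ∀ (Ω : Type*) [MeasurableSpace Ω] (μ : Measure Ω) [IsProbabilityMeasure μ]
            (A : Adversary Ω Plane),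
            Integrable (combinedError L c A T) (protocolLaw μ D) ∧
            ∫ p, combinedError L c A T p ∂(protocolLaw μ D)
              ≤ K * (T : ℝ) ^ (2 / 3 : ℝ) * (1 + Real.log T) ^ r := by
  refine ⟨fun sPos sNeg _ => hasCertificateDimension_anchoredHalfspaces sPos sNeg, 55, 1,
    fun T hT => ⟨voteLearner measurableSet_extends ⌈(T : ℝ) ^ (4 / 3 : ℝ)⌉₊, ?_⟩⟩
  rintro D _ c ⟨w, b, rfl⟩ Ω _ μ _ A
  have hα : 0 < ⌈(T : ℝ) ^ (4 / 3 : ℝ)⌉₊ := Nat.ceil_pos.2 (by positivity)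
  obtain ⟨h1, h2⟩ := integral_combinedError_le (D := D) (μ := μ) hα measurableSet_extends
    (measurable_halfspace w b) (d := fun x => |inner ℝ w x + b|) (by fun_prop)
    (marginCertified_halfspace w b) A hT
  exact ⟨h1, h2.trans (error_bound_le hT)⟩
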